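/- Let $n\ge 0$ and let $\omega\in\mathfrak S_n$. Fill the boxes $(r,c)$, $r,c\ge1$, $r+c\le n$ (row $r$ from the top, column $c$ from the left) of a triangular shape with crossings and contacts. At a contact, the pipe coming from the left turns up (the northwest pipe of the contact) and the pipe coming from below turns right (the southeast pipe); on the antidiagonal $r+c=n+1$ the only pipe turns from left to up. Pipe $i$ is the pipe entering at row $i$ on the left. Such a filling $P$ is a (reduced) pipe dream with exiting permutation $\omega$ if any two pipes cross at most once and, for each $i\in[n]$, pipe $i$ exits at column $\omega^{-1}(i)$ on the top. Its contact graph has an arc $i\to j$ for each contact with northwest pipe $i$ and southeast pipe $j$; $P$ is acyclic if this graph has no oriented cycle, and then $\lhd_P$ denotes the transitive closure of the contact graph. A permutation $\pi$ is a linear extension of $P$ if $\pi^{-1}(i)<\pi^{-1}(j)$ for every arc $i\to j$. Let $[e,\omega]$ be the interval below $\omega$ in the weak order (where $\pi\le\sigma$ if and only if, for all $i<j$, $\pi^{-1}(i)>\pi^{-1}(j)$ implies $\sigma^{-1}(i)>\sigma^{-1}(j)$). The pipe dream congruence $\equiv_\omega$ is the relation on $[e,\omega]$ whose classes are the sets of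 linear extensions of the acyclic pipe dreams with exiting permutation $\omega$. Permutations are written as words in one-line notation. 1. On $[e,\omega]$, the relation $\equiv_\omega$ coincides with the (reflexive, symmetric and) transitive closure of the rewriting rule $UijV\equiv UjiV$ between elements of $[e,\omega]$, where $1\le i<j\le n$ and $U,V$ are (possibly empty) words on $[n]$ such that $$\#\{k\in U : k>i\}\ \ge\ \#\{k\in U : \omega^{-1}(k)<\omega^{-1}(j)\}.$$ Moreover, two permutations $UijV$ and $UjiV$ of $[e,\omega]$ with $i<j$ are congruent for $\equiv_\omega$ if and only if this inequality holds. 2. A permutation $\pi\in[e,\omega]$ is minimal (resp. maximal) for the weak order in its $\equiv_\omega$-class if and only if it avoids the patterns $k_1-\cdots-k_p-ji$ (resp. $k_1-\cdots-k_p-ij$) with $i<j$, $p=\#\{k\in[i] : \omega^{-1}(k)<\omega^{-1}(j)\}$, and $k_q>i$ and $\omega^{-1}(k_q)>\omega^{-1}(j)$ for all $q\in[p]$. Here the two last letters of a pattern must be consecutive in $\pi$, and $k_1,\dots,k_p$ appear before them, in this order but not necessarily consecutively. 3. If $1\le i<j\le n$ and $j-i\le\#\{k\in[i] : \omega^{-1}(k)<\omega^{-1}(j)\}$,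 then $i\lhd_P j$ or $j\lhd_P i$ for every acyclic pipe dream $P$ with exiting permutation $\omega$. -/

import Mathlib

open Finset

/-!
Pipes, rows and columns are indexed from `0`, i.e. by `Fin n` or by natural numbers below `n`.
A permutation `ω : Equiv.Perm (Fin n)` is read in one-line notation as the word
`ω 0, ω 1, …, ω (n - 1)`, so `ω.symm k` is the position of the letter `k`.
-/

namespace PipeDreams

/-- A filling of the triangular shape with `n` rows and `n` columns. Its boxes are the `(r, c)`
(row `r` counted from the top, column `c` counted from the left) with `r + c < n`. The boxes
of the last antidiagonal `r + c + 1 = n` only carry the turn of one pipe from its row to its column;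
each other box is filled with a crossing (if it is in `crosses`) or with a contact. -/
structure Filling (n : ℕ) where
  crosses : Finset (ℕ × ℕ)
  support : ∀ b ∈ crosses, b.1 + b.2 + 1 < n

namespace Filling

variable {n : ℕ}

mutual

/-- The pipe entering the box `(r, c)` through its left side. Pipe `r` enters the shape at the left
side of the box `(r, 0)`. A pipe leaves a box through its right side if it goes straight
horizontally through a crossing, or if it comes from below and turns right at a contact. -/
def leftPipe (P : Filling n) : ℕ → ℕ → ℕ
  | r, 0 => r
  | r, c + 1 => if (r, c) ∈ P.crosses then P.leftPipe r c else P.topPipe (r + 1) c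
termination_by _ c => (c, 0)

/-- The pipe leaving the box `(r, c)` through its top side: at a crossing it comes from below,
otherwise it comes from the left and turns up. -/
def topPipe (P : Filling n) (r c : ℕ) : ℕ :=
  if _h : (r, c) ∈ P.crosses then P.topPipe (r + 1) c else P.leftPipe r c
termination_by (c, n - r + 1)
decreasing_by
  · have := P.support _ _h
    simp only at this
    exact Prod.Lex.right _ (by omega)
  · exact Prod.Lex.right _ (by omega)

end

/-- The pipe entering the box `(r, c)` through its bottom side (for `r + c + 1 < n`), that is, the
pipe leaving the box just below through its top side. -/
def bottomPipe (P : Filling n) (r c : ℕ) : ℕ := P.topPipe (r + 1) c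

/-- Reduced: two pipes have at most one crossing. -/
def IsReduced (P : Filling n) : Prop :=
  ∀ b ∈ P.crosses, ∀ b' ∈ P.crosses,
    s(P.leftPipe b.1 b.2, P.bottomPipe b.1 b.2) = s(P.leftPipe b'.1 b'.2, P.bottomPipe b'.1 b'.2) →
      b = b'

/-- The exit points of the pipes, read from left to right along the top side, give the word `ω`. -/
def HasExit (P : Filling n) (ω : Equiv.Perm (Fin n)) : Prop :=
  ∀ c : Fin n, P.topPipe 0 c = ω c

/-- The arcs of the contact graph: `i → j` if some contact has `i` as northwest pipe (coming from
the left and turning up) and `j` as southeast pipe (coming from below and turning right). -/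
def ContactArc (P : Filling n) (i j : Fin n) : Prop :=
  ∃ r c : ℕ, r + c + 1 < n ∧ (r, c) ∉ P.crosses ∧ P.leftPipe r c = i ∧ P.bottomPipe r c = j

/-- The relation `i ◁ j`: there is a (non-empty) directed path from `i` to `j` in the contact
graph. -/
def ContactLess (P : Filling n) (i j : Fin n) : Prop := Relation.TransGen P.ContactArc i j

/-- The contact graph has no oriented cycle. -/
def IsAcyclic (P : Filling n) : Prop := ∀ i : Fin n, ¬ P.ContactLess i i

/-- `P` is an acyclic (reduced) pipe dream with exiting permutation `ω`. -/
def IsAcyclicPipeDream (P : Filling n) (ω : Equiv.Perm (Fin n)) : Prop :=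
  P.IsReduced ∧ P.HasExit ω ∧ P.IsAcyclic

/-- `π` is a linear extension of the contact graph of `P`. -/
def IsLinearExtension (P : Filling n) (π : Equiv.Perm (Fin n)) : Prop :=
  ∀ i j : Fin n, P.ContactArc i j → π.symm i < π.symm j

end Filling

variable {n : ℕ}

/-- The weak order on permutations, by inclusion of inversion sets: every pair of values `i < j`
that is inverted in `π` is inverted in `ω`. -/
def WeakLE (π ω : Equiv.Perm (Fin n)) : Prop :=
  ∀ i j : Fin n, i < j → π.symm j < π.symm i → ω.symm j < ω.symm i

/-- The interval `[e, ω]` of the weak order. -/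
def WeakInterval (ω : Equiv.Perm (Fin n)) : Type := {π : Equiv.Perm (Fin n) // WeakLE π ω}

/-- The underlying permutation. -/
def WeakInterval.perm {ω : Equiv.Perm (Fin n)} (π : WeakInterval ω) : Equiv.Perm (Fin n) := π.1

theorem WeakLE.antisymm {π σ : Equiv.Perm (Fin n)} (h : WeakLE π σ) (h' : WeakLE σ π) :
    π = σ := by
  have key : ∀ i j : Fin n, π.symm i < π.symm j → σ.symm i < σ.symm j := by
    intro i j hij
    rcases lt_trichotomy i j with hlt | rfl | hlt
    · by_contra hc
      have hne : σ.symm j ≠ σ.symm i := fun he => hlt.ne' (σ.symm.injective he)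
      exact absurd (h' i j hlt (lt_of_le_of_ne (not_lt.mp hc) hne)) (not_lt.mpr hij.le)
    · exact absurd hij (lt_irrefl _)
    · exact h j i hlt hij
  have hmono : StrictMono (π.trans σ.symm) := by
    intro a b hab
    have := key (π a) (π b) (by simpa using hab)
    simpa using this
  have hid : (hmono.orderIsoOfSurjective _ (π.trans σ.symm).surjective) = OrderIso.refl (Fin n) :=
    Subsingleton.elim _ _
  ext a
  have h1 : σ.symm (π a) = a := by
    have := congrArg (fun f : Fin n ≃o Fin n => f a) hid
    simpa using this
  rw [Equiv.symm_apply_eq] at h1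
  rw [h1]

/-- The weak order on `[e, ω]`. -/
instance (ω : Equiv.Perm (Fin n)) : PartialOrder (WeakInterval ω) where
  le π σ := WeakLE π.perm σ.perm
  le_refl _ := fun _ _ _ h => h
  le_trans _ _ _ h h' := fun i j hij hπ => h' i j hij (h i j hij hπ)
  le_antisymm _ _ h h' := Subtype.ext (WeakLE.antisymm h h')

/-- The pipe dream congruence on `[e, ω]`: its classes are the sets of linear extensions of the
acyclic pipe dreams with exiting permutation `ω`. -/
def PipeDreamCongruent (ω : Equiv.Perm (Fin n)) (π σ : WeakInterval ω) : Prop :=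
  ∃ P : Filling n, P.IsAcyclicPipeDream ω ∧
    P.IsLinearExtension π.perm ∧ P.IsLinearExtension σ.perm

/-- The letters of the word `π` before the position `p`. -/
def lettersBefore (π : Equiv.Perm (Fin n)) (p : Fin n) : Finset (Fin n) :=
  {k | π.symm k < p}

/-- `p, q` are consecutive positions with `π = U i j V` and `σ = U j i V`, where `i < j` and `i`,
`j` are the letters of `π` at the positions `p`, `q`. -/
def IsSwapAt (π σ : Equiv.Perm (Fin n)) (p q : Fin n) : Prop :=
  (p : ℕ) + 1 = q ∧ π p < π q ∧ σ = π * Equiv.swap p q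

/-- The condition `#{k ∈ U | k > i} ≥ #{k ∈ U | ω⁻¹(k) < ω⁻¹(j)}`, where `π = U i j V` and
`i`, `j` are the letters of `π` at the consecutive positions `p`, `q`. -/
def SwapCondition (ω π : Equiv.Perm (Fin n)) (p q : Fin n) : Prop :=
  #{k ∈ lettersBefore π p | π p < k} ≥ #{k ∈ lettersBefore π p | ω.symm k < ω.symm (π q)}

/-- One application of the rewriting rule `U i j V ≡ U j i V` on `[e, ω]`. -/
def RewritingStep (ω : Equiv.Perm (Fin n)) (π σ : WeakInterval ω) : Prop :=
  ∃ p q : Fin n, IsSwapAt π.perm σ.perm p q ∧ SwapCondition ω π.perm p q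

/-- The part of the patterns before the dash preceding the letters `i`, `j`: a subword
`k₁ ⋯ kₘ` of the letters of `π` before position `p` with all `k_t > i` and `ω⁻¹(k_t) > ω⁻¹(j)`,
of length `m = #{k ≤ i | ω⁻¹(k) < ω⁻¹(j)}`. -/
def HasLargeSubwordBefore (ω π : Equiv.Perm (Fin n)) (p i j : Fin n) : Prop :=
  ∃ s : Fin #{k : Fin n | k ≤ i ∧ ω.symm k < ω.symm j} → Fin n, StrictMono s ∧
    ∀ t, s t < p ∧ i < π (s t) ∧ ω.symm j < ω.symm (π (s t))

/-- `π` contains a pattern `k₁ - ⋯ - kₘ - ji`, with `j i` at consecutive positions `p, q`. -/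
def ContainsDescentPattern (ω π : Equiv.Perm (Fin n)) : Prop :=
  ∃ p q i j : Fin n, (p : ℕ) + 1 = q ∧ i < j ∧ π p = j ∧ π q = i ∧
    HasLargeSubwordBefore ω π p i j

/-- `π` contains a pattern `k₁ - ⋯ - kₘ - ij`, with `i j` at consecutive positions `p, q`. -/
def ContainsAscentPattern (ω π : Equiv.Perm (Fin n)) : Prop :=
  ∃ p q i j : Fin n, (p : ℕ) + 1 = q ∧ i < j ∧ π p = i ∧ π q = j ∧
    HasLargeSubwordBefore ω π p i j

end PipeDreams

-- Sweep the shape column by column, each from bottom to top. The pipes along the moving frontier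
-- form a word, initially the identity; the box of column `c` on antidiagonal `m` exchanges its
-- letters at positions `m`, `m + 1` (crossing) or keeps them (contact). Reducedness means that
-- every crossing creates an inversion (`isReduced_iff`), so inversions of the word are never
-- undone.
--
-- The main geometric fact is `rel_of_above_at_exit`: if a pipe `y` enters its exit column above
-- `z`, the contact graph has a path from `y` to `z`. Hence the exits and one linear extension
-- decide every box during the sweep (`isCross_iff`), so at most one pipe dream has a given linear
-- extension. Running the same rule on any `π ≤ ω` does produce a pipe dream with exits `ω` and
-- linear extension `π` (`exists_isLinearExtension`). The classes therefore partition `[e, ω]`.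
--
-- Consecutive letters `i < j` of a linear extension can be exchanged inside the class exactly when
-- there is no contact from `i` to `j`. Among the pipes preceding `i`, compare those starting below
-- `i` with those exiting before `j`: until `j` exits, as long as no such contact occurs, each exit
-- of a preceding pipe uses up exactly one preceding pipe below `i`. A contact occurs exactly when
-- this supply runs out (`exists_contact_iff`), which is the failure of the swap inequality.
--
-- Two linear extensions of one graph are joined by adjacent exchanges, which gives the rewriting
-- rule and reduces extremality to single exchanges; cancelling the letters counted on both sides of
-- the inequality gives the patterns. Finally, incomparable pipes `i < j` would be consecutive in
-- some linear extension, and the inequality would then require more values strictly between `i` and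
-- `j` than there are.

namespace PipeDreams

-- Words of the column sweep

open Classical in
/-- The words met while sweeping the triangular shape column by column, each from bottom to top.
The box of column `c` on the antidiagonal `r + c = m` acts on the positions `m` and `m + 1`;
it exchanges their letters if `D c m` holds for the current word. -/
noncomputable def sweep (n : ℕ) (D : ℕ → ℕ → Equiv.Perm ℕ → Prop) : ℕ → Equiv.Perm ℕ
  | 0 => 1
  | t + 1 =>
    if D (t / n) (n - 1 - t % n) (sweep n D t) then
      sweep n D t * Equiv.swap (n - 1 - t % n) (n - 1 - t % n + 1)
    else sweep n D t

theorem sweep_congr {n : ℕ} {D D' : ℕ → ℕ → Equiv.Perm ℕ → Prop}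
    (h : ∀ t, D (t / n) (n - 1 - t % n) (sweep n D t) ↔
      D' (t / n) (n - 1 - t % n) (sweep n D t)) (t : ℕ) : sweep n D t = sweep n D' t := by
  induction t with
  | zero => rfl
  | succ t ih =>
    rw [sweep, sweep, ← ih]
    by_cases hd : D (t / n) (n - 1 - t % n) (sweep n D t)
    · rw [if_pos hd, if_pos ((h t).1 hd)]
    · rw [if_neg hd, if_neg fun h' => hd ((h t).2 h')]

theorem time_div {n c m : ℕ} (hm : m < n) : (c * n + (n - (m + 1))) / n = c := by
  rw [Nat.add_comm, Nat.add_mul_div_right _ _ (by omega), Nat.div_eq_of_lt (by omega)]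
  omega

theorem time_mod {n c m : ℕ} (hm : m < n) :
    n - 1 - (c * n + (n - (m + 1))) % n = m := by
  rw [Nat.add_comm, Nat.add_mul_mod_self_right, Nat.mod_eq_of_lt (by omega)]
  omega

-- Fillings as sweeps and positions of pipes

namespace Filling

variable {n : ℕ} (P : Filling n)

/-- The box of column `c` and antidiagonal `m` is a crossing. -/
def IsCross (c m : ℕ) : Prop := c ≤ m ∧ (m - c, c) ∈ P.crosses

/-- The word after the sweep of the boxes of the first `c` columns and of the boxes `(r, c)` with
`m ≤ r + c` of the next one. -/
noncomputable def word (c m : ℕ) : Equiv.Perm ℕ :=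
  sweep n (fun c m _ => P.IsCross c m) (c * n + (n - m))

/-- The position of a letter in the word. -/
noncomputable def pos (c m x : ℕ) : ℕ := (P.word c m).symm x

variable {P}

theorem IsCross.lt {c m : ℕ} (h : P.IsCross c m) : m + 1 < n := by
  have h1 := P.support _ h.2
  have h2 := h.1
  simp only at h1
  omega

theorem IsCross.le {c m : ℕ} (h : P.IsCross c m) : c ≤ m := h.1

theorem isCross_add {r c : ℕ} : P.IsCross c (r + c) ↔ (r, c) ∈ P.crosses := by
  simp [IsCross]

variable (P)

theorem word_zero : P.word 0 n = 1 := by simp [word, sweep]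

theorem word_succ (c : ℕ) : P.word (c + 1) n = P.word c 0 := by
  simp [word, Nat.succ_mul]

open Classical in
theorem word_step (c m : ℕ) : P.word c m =
    if P.IsCross c m then P.word c (m + 1) * Equiv.swap m (m + 1) else P.word c (m + 1) := by
  rcases lt_or_ge m n with hm | hm
  · have h1 : c * n + (n - m) = c * n + (n - (m + 1)) + 1 := by omega
    simp only [word]
    rw [h1, sweep, time_div hm, time_mod hm]
  · have h1 : n - m = n - (m + 1) := by omega
    rw [if_neg (fun h => by have := h.lt; omega)]
    simp only [word, h1]

theorem pos_word (c m p : ℕ) : P.pos c m (P.word c m p) = p := by simp [pos]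

variable {P} in
theorem word_eq_iff {c m p x : ℕ} : P.word c m p = x ↔ P.pos c m x = p := by
  rw [pos, Equiv.symm_apply_eq, eq_comm]

variable {P} in
theorem pos_injective {c m x y : ℕ} (h : P.pos c m x = P.pos c m y) : x = y :=
  (P.word c m).symm.injective h

theorem pos_zero (x : ℕ) : P.pos 0 n x = x := by rw [pos, word_zero]; rfl

theorem pos_succ (c x : ℕ) : P.pos (c + 1) n x = P.pos c 0 x := by simp [pos, word_succ]

open Classical in
theorem pos_step (c m x : ℕ) : P.pos c m x =
    if P.IsCross c m ∧ P.pos c (m + 1) x = m then m + 1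
    else if P.IsCross c m ∧ P.pos c (m + 1) x = m + 1 then m else P.pos c (m + 1) x := by
  by_cases h : P.IsCross c m
  · simp only [h, true_and]
    have : P.pos c m x = Equiv.swap m (m + 1) (P.pos c (m + 1) x) := by
      simp only [pos]
      rw [P.word_step c m, if_pos h, Equiv.symm_apply_eq, Equiv.Perm.mul_apply,
        Equiv.swap_apply_self, Equiv.apply_symm_apply]
    rw [this, Equiv.swap_apply_def]
  · simp only [h, false_and, if_false]
    simp only [pos]
    rw [P.word_step c m, if_neg h]

variable {P} in
theorem pos_of_not_isCross {c m : ℕ} (h : ¬ P.IsCross c m) (x : ℕ) :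
    P.pos c m x = P.pos c (m + 1) x := by
  rw [P.pos_step]; simp [h]

/-- The letters at the positions below `m` are not moved before the box on antidiagonal `m`. -/
theorem pos_eq_start {c m x : ℕ} (h : P.pos c n x < m) : P.pos c m x = P.pos c n x := by
  rcases le_total m n with hm | hm
  · revert h
    induction hm using Nat.decreasingInduction with
    | self => exact fun _ => rfl
    | of_succ k hk ih =>
      intro h
      have := ih (by omega)
      rw [P.pos_step, this, if_neg (by omega), if_neg (by omega)]
  · clear h
    induction m, hm using Nat.le_induction with
    | base => rfl
    | succ m hm ih =>
      rw [← ih, P.pos_step c m, if_neg (fun h => by have := h.1.lt; omega),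
        if_neg (fun h => by have := h.1.lt; omega)]

theorem le_pos_of_le_start {c m x : ℕ} (h : m ≤ P.pos c n x) : m ≤ P.pos c m x := by
  by_contra hc
  push Not at hc
  have h1 := P.pos_eq_start (c := c) (m := m) (x := P.word c n (P.pos c m x))
    (by rw [pos_word]; exact hc)
  rw [pos_word] at h1
  have h2 := pos_injective h1
  rw [word_eq_iff] at h2
  omega

/-- The letters at the positions above `m` are not moved after the box on antidiagonal `m`. -/
theorem pos_eq_of_lt {c m x : ℕ} (h : m < P.pos c m x) {k : ℕ} (hk : k ≤ m) :
    P.pos c k x = P.pos c m x := by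
  induction hk using Nat.decreasingInduction with
  | self => rfl
  | of_succ k hk ih =>
    rw [P.pos_step, ih, if_neg (by omega), if_neg (by omega)]

theorem pos_le_of_le {c m x : ℕ} (h : P.pos c m x ≤ m) {k : ℕ} (hk : k ≤ m) :
    P.pos c k x ≤ m := by
  by_contra hc
  push Not at hc
  have h1 := P.pos_eq_of_lt (c := c) (m := m) (x := P.word c m (P.pos c k x)) (by simpa [pos_word])
    hk
  rw [pos_word] at h1
  have h2 := pos_injective h1
  rw [word_eq_iff] at h2
  omega

theorem pos_lt_iff (c m x : ℕ) : P.pos c m x < n ↔ x < n := by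
  have hcol : ∀ c, (P.pos c n x < n ↔ x < n) → ∀ m, m ≤ n → (P.pos c m x < n ↔ x < n) := by
    intro c h m hm
    induction hm using Nat.decreasingInduction with
    | self => exact h
    | of_succ k hk ih =>
      rw [P.pos_step, ← ih]
      split_ifs with h1 h2
      · have := h1.1.lt; omega
      · have := h2.1.lt; omega
      · rfl
  have hst : ∀ c, (P.pos c n x < n ↔ x < n) := by
    intro c
    induction c with
    | zero => rw [pos_zero]
    | succ c ih => rw [pos_succ]; exact hcol c ih 0 (by omega)
  rcases le_total m n with hm | hm
  · exact hcol c (hst c) m hm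
  · rw [← hst c]
    have : P.word c m = P.word c n := by simp [word, Nat.sub_eq_zero_of_le hm]
    simp [pos, this]

theorem word_lt_iff (c m p : ℕ) : P.word c m p < n ↔ p < n := by
  rw [← P.pos_lt_iff c m, pos_word]

/-- A letter at a position before `c` has left the shape. -/
theorem pos_eq_of_lt_col {c m x : ℕ} (h : P.pos c n x < c) (hm : m ≤ n) :
    P.pos c m x = P.pos c n x := by
  induction hm using Nat.decreasingInduction with
  | self => rfl
  | of_succ k hk ih =>
    rw [P.pos_step, ih, if_neg (fun h => by have := h.1.le; omega),
      if_neg (fun h => by have := h.1.le; omega)]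

theorem pos_const_of_lt {c x : ℕ} (h : P.pos c n x < c) {c' : ℕ} (hc : c ≤ c') :
    P.pos c' n x = P.pos c n x := by
  induction c', hc using Nat.le_induction with
  | base => rfl
  | succ d hd ih =>
    rw [pos_succ, ← ih, P.pos_eq_of_lt_col (by omega) (by omega)]

theorem leftPipe_zero (r : ℕ) : P.leftPipe r 0 = r := by rw [leftPipe]

theorem leftPipe_succ (r c : ℕ) : P.leftPipe r (c + 1) =
    if (r, c) ∈ P.crosses then P.leftPipe r c else P.topPipe (r + 1) c := by rw [leftPipe]

theorem topPipe_eq (r c : ℕ) : P.topPipe r c =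
    if (r, c) ∈ P.crosses then P.topPipe (r + 1) c else P.leftPipe r c := by
  rw [topPipe]; simp

/-- Within a column, the boxes strictly below row `r` only touch positions larger than `r + c`, so
the letter there is still the pipe entering from the left; the boxes strictly above only touch
positions at most `r + c`, so what is left at `r + c + 1` is the pipe leaving to the right. -/
theorem pipes_eq_word (c : ℕ) : (∀ r, P.leftPipe r c = P.word c n (r + c)) ∧
    ∀ r, P.topPipe r c = P.word c (r + c) (r + c) := by
  have htop : ∀ c, (∀ r, P.leftPipe r c = P.word c n (r + c)) →
      ∀ r, P.topPipe r c = P.word c (r + c) (r + c) := by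
    intro c hl
    have hnot : ∀ r, (r, c) ∉ P.crosses → P.topPipe r c = P.word c (r + c) (r + c) := by
      intro r hr
      rw [topPipe_eq, if_neg hr, hl, eq_comm, word_eq_iff,
        pos_of_not_isCross (by rwa [isCross_add]), P.pos_eq_start, pos_word]
      rw [pos_word]; omega
    have hall : ∀ k r, n ≤ r + k → P.topPipe r c = P.word c (r + c) (r + c) := by
      intro k
      induction k with
      | zero =>
        intro r hr
        exact hnot r fun h => by have := P.support _ h; simp only at this; omega
      | succ k ih =>
        intro r hr
        by_cases h : (r, c) ∈ P.crosses
        · rw [topPipe_eq, if_pos h, ih (r + 1) (by omega), P.word_step c (r + c),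
            if_pos (by rwa [isCross_add]), Equiv.Perm.mul_apply, Equiv.swap_apply_left,
            Nat.add_right_comm r 1 c]
        · exact hnot r h
    exact fun r => hall n r (by omega)
  have hleft : ∀ r, P.leftPipe r c = P.word c n (r + c) := by
    induction c with
    | zero => intro r; rw [leftPipe_zero, word_zero]; rfl
    | succ c ih =>
      intro r
      have hend : P.word c 0 (r + c + 1) = P.word c (r + c) (r + c + 1) := by
        rw [word_eq_iff, P.pos_eq_of_lt (m := r + c), pos_word]
        · rw [pos_word]; omega
        · omega
      rw [leftPipe_succ, word_succ, ← add_assoc, hend, P.word_step c (r + c)]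
      by_cases h : (r, c) ∈ P.crosses
      · rw [if_pos h, if_pos (by rwa [isCross_add]), Equiv.Perm.mul_apply,
          Equiv.swap_apply_right, ih, eq_comm, word_eq_iff, P.pos_eq_start, pos_word]
        rw [pos_word]; omega
      · rw [if_neg h, if_neg (by rwa [isCross_add]), htop c ih, Nat.add_right_comm r 1 c]
  exact ⟨hleft, htop c hleft⟩

/-- The pipe coming from the left in the box of column `c` and antidiagonal `m`. -/
noncomputable def west (c m : ℕ) : ℕ := P.word c (m + 1) m

/-- The pipe coming from below in the box of column `c` and antidiagonal `m`. -/
noncomputable def south (c m : ℕ) : ℕ := P.word c (m + 1) (m + 1)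

theorem leftPipe_eq_west (r c : ℕ) : P.leftPipe r c = P.west c (r + c) := by
  rw [(P.pipes_eq_word c).1, west, eq_comm, word_eq_iff, P.pos_eq_start, pos_word]
  rw [pos_word]; omega

theorem bottomPipe_eq_south (r c : ℕ) : P.bottomPipe r c = P.south c (r + c) := by
  rw [bottomPipe, (P.pipes_eq_word c).2, south, Nat.add_right_comm r 1 c]

theorem pos_west (c m : ℕ) : P.pos c (m + 1) (P.west c m) = m := pos_word ..

theorem pos_south (c m : ℕ) : P.pos c (m + 1) (P.south c m) = m + 1 := pos_word ..

variable {P} in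
theorem eq_west {c m x : ℕ} (h : P.pos c (m + 1) x = m) : P.west c m = x := word_eq_iff.2 h

variable {P} in
theorem eq_south {c m x : ℕ} (h : P.pos c (m + 1) x = m + 1) : P.south c m = x := word_eq_iff.2 h

/-- The carried pipe after a crossing. -/
theorem IsCross.word_self {c m : ℕ} {P : Filling n} (h : P.IsCross c m) :
    P.word c m m = P.south c m := by
  rw [P.word_step, if_pos h, Equiv.Perm.mul_apply, Equiv.swap_apply_left, south]

/-- The carried pipe after a contact. -/
theorem word_self_of_not {c m : ℕ} {P : Filling n} (h : ¬ P.IsCross c m) :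
    P.word c m m = P.west c m := by
  rw [P.word_step, if_neg h, west]

theorem topPipe_zero (c : ℕ) : P.topPipe 0 c = P.word c c c := by
  simpa using (P.pipes_eq_word c).2 0

theorem word_end (c : ℕ) : P.word (c + 1) n c = P.word c c c := by
  have hcol : ∀ m, m ≤ c → P.word c m = P.word c c := by
    intro m hm
    induction hm using Nat.decreasingInduction with
    | self => rfl
    | of_succ k hk ih => rw [P.word_step, if_neg (fun h => by have := h.le; omega), ih]
  rw [word_succ, hcol 0 (by omega)]

/-- This allows a filling to be defined by a rule that reads the word produced by its own earlier
boxes: the sweep is run first with the rule, its exchanges are recorded as crossings, and the sweep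
of the recorded filling is the same. -/
theorem exists_isCross_iff (D : ℕ → ℕ → Equiv.Perm ℕ → Prop) : ∃ P : Filling n,
    ∀ c m, P.IsCross c m ↔ c ≤ m ∧ m + 1 < n ∧ D c m (P.word c (m + 1)) := by
  classical
  let D' : ℕ → ℕ → Equiv.Perm ℕ → Prop := fun c m w => c ≤ m ∧ m + 1 < n ∧ D c m w
  let P : Filling n :=
    { crosses := {b ∈ range n ×ˢ range n | b.1 + b.2 + 1 < n ∧
        D b.2 (b.1 + b.2) (sweep n D' (b.2 * n + (n - (b.1 + b.2 + 1))))}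
      support := fun b hb => (mem_filter.1 hb).2.1 }
  have hP : ∀ c m, P.IsCross c m ↔ D' c m (sweep n D' (c * n + (n - (m + 1)))) := by
    intro c m
    simp only [IsCross, P, mem_filter, mem_product, mem_range, D']
    constructor
    · rintro ⟨h1, -, h2, h3⟩
      rw [Nat.sub_add_cancel h1] at h2 h3
      exact ⟨h1, h2, h3⟩
    · rintro ⟨h1, h2, h3⟩
      rw [Nat.sub_add_cancel h1]
      exact ⟨h1, ⟨by omega, by omega⟩, h2, h3⟩
  refine ⟨P, fun c m => ?_⟩
  have hw : ∀ t, sweep n D' t = sweep n (fun c m _ => P.IsCross c m) t := by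
    refine sweep_congr fun t => ?_
    rw [hP]
    rcases Nat.eq_zero_or_pos n with rfl | hn
    · simp [D']
    · have h1 : t % n < n := Nat.mod_lt _ hn
      have h2 : t / n * n + (n - (n - 1 - t % n + 1)) = t := by
        have := Nat.div_add_mod' t n
        omega
      rw [h2]
  rw [hP, hw]
  rfl

end Filling

-- Crossings and inversions in reduced fillings

namespace Filling

variable {n : ℕ} {P : Filling n}

/-- Induction along the sweep, the form in which all its invariants are propagated: `m` decreases
from `n` to `0`, then the next column starts. -/
theorem column_induction {Q : ℕ → ℕ → Prop} {c m c' m' : ℕ}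
    (hsucc : ∀ c, Q c 0 → Q (c + 1) n) (hstep : ∀ c m, m < n → Q c (m + 1) → Q c m)
    (hm : m ≤ n) (hm' : m' ≤ n) (hle : c < c' ∨ c = c' ∧ m' ≤ m) (h : Q c m) : Q c' m' := by
  have hdown : ∀ c m m', m' ≤ m → m ≤ n → Q c m → Q c m' := by
    intro c m m' hle hm h
    induction hle using Nat.decreasingInduction with
    | self => exact h
    | of_succ k hk ih => exact hstep c k (by omega) ih
  rcases hle with hc | ⟨rfl, hle⟩
  · have hstart : Q c' n := by
      induction c', hc using Nat.le_induction with
      | base => exact hsucc c (hdown c m 0 (by omega) hm h)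
      | succ d hd ih => exact hsucc d (hdown d n 0 (by omega) le_rfl ih)
    exact hdown c' n m' hm' le_rfl hstart
  · exact hdown c m m' hle hm h

theorem lt_or_cross_of_lt {c m x y : ℕ} (h : P.pos c (m + 1) x < P.pos c (m + 1) y) :
    P.pos c m x < P.pos c m y ∨ P.IsCross c m ∧ P.west c m = x ∧ P.south c m = y := by
  by_cases hc : P.IsCross c m ∧ P.pos c (m + 1) x = m ∧ P.pos c (m + 1) y = m + 1
  · exact Or.inr ⟨hc.1, eq_west hc.2.1, eq_south hc.2.2⟩
  · left
    rw [P.pos_step c m x, P.pos_step c m y]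
    split_ifs with h1 h2 h3 h4 h5 h6 <;> first | omega | (exfalso; tauto) | skip
    all_goals
      by_contra
      exact hc ⟨by tauto, by omega, by omega⟩

theorem lt_or_cross_of_lt_after {c m x y : ℕ} (h : P.pos c m x < P.pos c m y) :
    P.pos c (m + 1) x < P.pos c (m + 1) y ∨
      P.IsCross c m ∧ P.west c m = y ∧ P.south c m = x := by
  by_contra hc
  push Not at hc
  have hne : P.pos c (m + 1) x ≠ P.pos c (m + 1) y := by
    intro he
    rw [pos_injective he] at h
    exact lt_irrefl _ h
  rcases lt_or_cross_of_lt (lt_of_le_of_ne hc.1 hne.symm) with h1 | h1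
  · omega
  · exact hc.2 h1.1 h1.2.1 h1.2.2

theorem IsCross.pos_west {c m : ℕ} (h : P.IsCross c m) : P.pos c m (P.west c m) = m + 1 := by
  rw [P.pos_step, if_pos ⟨h, P.pos_west c m⟩]

theorem IsCross.pos_south {c m : ℕ} (h : P.IsCross c m) : P.pos c m (P.south c m) = m := by
  rw [P.pos_step, if_neg (by rw [P.pos_south]; omega), if_pos ⟨h, P.pos_south c m⟩]

theorem west_lt {c m : ℕ} (hm : m + 1 < n) : P.west c m < n :=
  (P.word_lt_iff _ _ _).2 (by omega)

theorem south_lt {c m : ℕ} (hm : m + 1 < n) : P.south c m < n :=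
  (P.word_lt_iff _ _ _).2 hm

/-- All crossings create an inversion of the word. -/
def IsIncreasing (P : Filling n) : Prop := ∀ c m, P.IsCross c m → P.west c m < P.south c m

theorem isReduced_iff_boxes : P.IsReduced ↔ ∀ c m c' m', P.IsCross c m → P.IsCross c' m' →
    s(P.west c m, P.south c m) = s(P.west c' m', P.south c' m') → c = c' ∧ m = m' := by
  constructor
  · intro h c m c' m' hX hX' he
    have h1 := h _ hX.2 _ hX'.2
    simp only [leftPipe_eq_west, bottomPipe_eq_south, Nat.sub_add_cancel hX.1,
      Nat.sub_add_cancel hX'.1, Prod.mk.injEq] at h1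
    have h2 := h1 he
    have := hX.1
    have := hX'.1
    omega
  · rintro h ⟨r, c⟩ hb ⟨r', c'⟩ hb' he
    simp only [leftPipe_eq_west, bottomPipe_eq_south] at he
    have := h c (r + c) c' (r' + c') (isCross_add.2 hb) (isCross_add.2 hb') he
    ext
    · simp only; omega
    · exact this.1

/-- A pair whose order changed has crossed. -/
theorem exists_cross_of_inverted {c m : ℕ} (hm : m ≤ n) {x y : ℕ} (hxy : x < y)
    (h : P.pos c m y < P.pos c m x) : ∃ c' m', P.IsCross c' m' ∧ (c' < c ∨ c' = c ∧ m ≤ m') ∧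
      s(P.west c' m', P.south c' m') = s(x, y) := by
  revert h
  refine column_induction (Q := fun c m => P.pos c m y < P.pos c m x → ∃ c' m', P.IsCross c' m' ∧
    (c' < c ∨ c' = c ∧ m ≤ m') ∧ s(P.west c' m', P.south c' m') = s(x, y))
    (c := 0) (m := n) ?_ ?_ le_rfl hm (by omega) ?_
  · intro c ih h
    simp only [pos_succ] at h
    obtain ⟨c', m', h1, h2, h3⟩ := ih h
    exact ⟨c', m', h1, by omega, h3⟩
  · intro c m hm ih h
    rcases lt_or_cross_of_lt_after h with h1 | h1
    · obtain ⟨c', m', h1, h2, h3⟩ := ih h1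
      exact ⟨c', m', h1, by omega, h3⟩
    · exact ⟨c, m, h1.1, by omega, by rw [h1.2.1, h1.2.2]⟩
  · intro h
    rw [pos_zero, pos_zero] at h
    omega

theorem IsIncreasing.inverted_mono (hR : P.IsIncreasing) {c m c' m' x y : ℕ} (hxy : x < y)
    (h : P.pos c m y < P.pos c m x) (hm : m ≤ n) (hm' : m' ≤ n)
    (hle : c < c' ∨ c = c' ∧ m' ≤ m) : P.pos c' m' y < P.pos c' m' x := by
  refine column_induction (Q := fun c m => P.pos c m y < P.pos c m x) ?_ ?_ hm hm' hle h
  · intro c h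
    simpa only [pos_succ] using h
  · intro c m hm h
    rcases lt_or_cross_of_lt h with h1 | ⟨h1, h2, h3⟩
    · exact h1
    · have := hR c m h1
      omega

/-- A crossing that undoes an inversion involves a pair which has already crossed. Conversely, if
crossings only create inversions, a pair that has crossed stays inverted and cannot meet again in
the required order. -/
theorem isReduced_iff : P.IsReduced ↔ P.IsIncreasing := by
  rw [isReduced_iff_boxes]
  constructor
  · intro h c m hX
    by_contra hc
    have hlt := hX.lt
    have hne : P.west c m ≠ P.south c m := by
      intro he
      have := P.pos_west c m
      rw [he, P.pos_south] at this
      omega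
    obtain ⟨c', m', h1, h2, h3⟩ := P.exists_cross_of_inverted (c := c) (m := m + 1) (by omega)
      (show P.south c m < P.west c m by omega) (by rw [P.pos_south, P.pos_west]; omega)
    have := h c' m' c m h1 hX (by rw [h3, Sym2.eq_swap])
    omega
  · intro hR
    have key : ∀ c m c' m', P.IsCross c m → P.IsCross c' m' →
        s(P.west c m, P.south c m) = s(P.west c' m', P.south c' m') →
        ¬ (c < c' ∨ c = c' ∧ m' + 1 ≤ m) := by
      intro c m c' m' hX hX' he hle
      have h1 := hR c m hX
      have h2 := hR c' m' hX'
      have h3 : P.west c m = P.west c' m' ∧ P.south c m = P.south c' m' := by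
        rcases Sym2.eq_iff.1 he with h | h
        · exact h
        · omega
      have h4 := hR.inverted_mono h1 (c := c) (m := m) (by rw [hX.pos_west, hX.pos_south]; omega)
        (by have := hX.lt; omega) (m' := m' + 1) (by have := hX'.lt; omega) hle
      rw [h3.1, h3.2, P.pos_south, P.pos_west] at h4
      omega
    intro c m c' m' hX hX' he
    have h1 := key c m c' m' hX hX' he
    have h2 := key c' m' c m hX' hX he.symm
    omega

-- Exit columns

/-- The column in which a pipe leaves the shape. -/
noncomputable def exitCol (P : Filling n) (x : ℕ) : ℕ := P.pos n n x

theorem exitCol_injective {x y : ℕ} (h : P.exitCol x = P.exitCol y) : x = y := pos_injective h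

theorem exitCol_lt {x : ℕ} : P.exitCol x < n ↔ x < n := P.pos_lt_iff n n x

theorem exitCol_of_lt {c x : ℕ} (hc : c ≤ n) (h : P.pos c n x < c) :
    P.exitCol x = P.pos c n x := P.pos_const_of_lt h hc

theorem exitCol_word {c : ℕ} (hc : c < n) : P.exitCol (P.word c c c) = c := by
  have h : P.pos (c + 1) n (P.word c c c) = c := by rw [← word_end, pos_word]
  rw [exitCol_of_lt (c := c + 1) (by omega) (by omega), h]

theorem word_eq_of_exitCol {c x : ℕ} (hc : c < n) (h : P.exitCol x = c) : P.word c c c = x :=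
  exitCol_injective (by rw [exitCol_word hc, h])

theorem le_exitCol_iff {c x : ℕ} (hc : c ≤ n) : c ≤ P.exitCol x ↔ c ≤ P.pos c n x := by
  constructor
  · intro h
    by_contra hlt
    have := exitCol_of_lt (P := P) hc (by omega : P.pos c n x < c)
    omega
  · intro h
    by_contra hlt
    push Not at hlt
    have h1 : P.pos (P.exitCol x + 1) n x = P.exitCol x := by
      rw [← word_eq_iff, word_end, word_eq_of_exitCol (by omega) rfl]
    have h2 := P.pos_const_of_lt (c := P.exitCol x + 1) (x := x) (by omega) (c' := c) (by omega)
    omega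

theorem le_exitCol_iff' {c m x : ℕ} (hc : c ≤ n) (hm : m ≤ n) :
    c ≤ P.exitCol x ↔ c ≤ P.pos c m x := by
  rw [le_exitCol_iff hc]
  constructor
  · intro h
    by_contra hlt
    push Not at hlt
    have h1 : P.pos c m (P.word c n (P.pos c m x)) = P.pos c n (P.word c n (P.pos c m x)) :=
      P.pos_eq_of_lt_col (by rw [pos_word]; exact hlt) hm
    rw [pos_word] at h1
    have h2 := pos_injective h1
    rw [word_eq_iff] at h2
    omega
  · intro h
    by_contra hlt
    have := P.pos_eq_of_lt_col (by omega : P.pos c n x < c) hm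
    omega

/-- The rest of the column only moves positions at most `m`, so `x` stays beyond position `c` and
enters the next column. -/
theorem lt_exitCol_of_lt_pos {c m x : ℕ} (hc : c < n) (hcm : c ≤ m) (h : m < P.pos c m x) :
    c < P.exitCol x := by
  have h1 := P.pos_eq_of_lt h (Nat.zero_le m)
  rw [← Nat.succ_le_iff, Nat.succ_eq_add_one, le_exitCol_iff (by omega), pos_succ]
  omega

theorem IsCross.lt_exitCol_west {c m : ℕ} (h : P.IsCross c m) : c < P.exitCol (P.west c m) :=
  lt_exitCol_of_lt_pos (by have := h.lt; have := h.le; omega) h.le (by rw [h.pos_west]; omega)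

theorem lt_exitCol_south {c m : ℕ} (hcm : c ≤ m) (hm : m + 1 < n) (h : ¬ P.IsCross c m) :
    c < P.exitCol (P.south c m) :=
  lt_exitCol_of_lt_pos (by omega) hcm (by rw [pos_of_not_isCross h, P.pos_south]; omega)

theorem le_exitCol_south {c m : ℕ} (hcm : c ≤ m) (hm : m + 1 < n) :
    c ≤ P.exitCol (P.south c m) := by
  rw [le_exitCol_iff' (m := m + 1) (by omega) (by omega), P.pos_south]
  omega

-- Paths in the contact graph and the rule deciding each box

/-- A relation on pipes which contains the contact graph. -/
def ContainsArcs (P : Filling n) (R : ℕ → ℕ → Prop) : Prop :=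
  ∀ c m, c ≤ m → m + 1 < n → ¬ P.IsCross c m → R (P.west c m) (P.south c m)

/-- If the pipe `y` enters its exit column above the pipe `z`, then there is a path from `y` to `z`
in the contact graph. -/
theorem IsIncreasing.rel_of_above_at_exit (hR : P.IsIncreasing) {R : ℕ → ℕ → Prop}
    (htrans : ∀ x y z, R x y → R y z → R x z) (harc : P.ContainsArcs R) {y z : ℕ} (hz : z < n)
    (h : P.pos (P.exitCol y) n y < P.pos (P.exitCol y) n z) : R y z := by
  -- Downward induction on the exit column `d` of `y`; `k` bounds the number of remaining columns.
  suffices H : ∀ k d, n ≤ d + k → ∀ y z, z < n → P.exitCol y = d →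
      P.pos d n y < P.pos d n z → R y z from H n _ (by omega) y z hz rfl h
  clear h hz y z
  intro k
  induction k with
  | zero =>
    intro d hd y z hz hy h
    have := (P.pos_lt_iff d n z).2 hz
    have : d ≤ P.pos d n y := by
      have hyn : y < n := (P.pos_lt_iff d n y).1 (by omega)
      have := exitCol_lt (P := P).2 hyn
      omega
    omega
  | succ k ih =>
    intro c hd y z hz hy h
    have hyn : y < n := by
      have := (P.pos_lt_iff c n z).2 hz
      exact (P.pos_lt_iff c n y).1 (by omega)
    have hcn : c < n := by have := exitCol_lt (P := P).2 hyn; omega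
    -- At a contact, the new carried pipe has an arc to the old one. If the old one is not yet known
    -- to precede `z`, it is inverted with `z` and exits in a later column, still above `z`, so the
    -- induction hypothesis supplies the path.
    have main : ∀ m, c ≤ m → m < n → ¬ P.IsCross c m →
        (∀ z < n, m + 1 < P.pos c (m + 1) z →
          R (P.south c m) z ∨ z < P.south c m) →
        ∀ z < n, m < P.pos c m z → R (P.west c m) z := by
      intro m hcm hm hX hinv z hz hpos
      rw [pos_of_not_isCross hX] at hpos
      have hzn := (P.pos_lt_iff c (m + 1) z).2 hz
      have ha := harc c m hcm (by omega) hX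
      rcases Nat.lt_or_ge (m + 1) (P.pos c (m + 1) z) with hlt | hge
      · refine htrans _ _ _ ha ?_
        rcases hinv z hz hlt with h1 | h1
        · exact h1
        · have hex := lt_exitCol_south hcm (by omega) hX
          have hsn := P.south_lt (c := c) (m := m) (by omega)
          have hex' := exitCol_lt (P := P).2 hsn
          refine ih (P.exitCol (P.south c m)) (by omega) _ z hz rfl ?_
          exact hR.inverted_mono h1 (c := c) (m := m + 1) (by rw [P.pos_south]; exact hlt)
            (by omega) le_rfl (by omega)
      · rwa [← eq_south (show P.pos c (m + 1) z = m + 1 by omega)]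
    -- Going up the column, the carried pipe precedes each pipe left below it or has a larger label;
    -- the second case arises when it crosses that pipe.
    have inv : ∀ m, c ≤ m → m ≤ n → ∀ z < n, m < P.pos c m z →
        R (P.word c m m) z ∨ z < P.word c m m := by
      intro m hcm hm
      induction hm using Nat.decreasingInduction with
      | self =>
        intro z hz hpos
        have := (P.pos_lt_iff c n z).2 hz
        omega
      | of_succ m hm ih' =>
        have ih' := ih' (by omega)
        intro z hz hpos
        by_cases hX : P.IsCross c m
        · rw [hX.word_self]
          rcases lt_or_ge (m + 1) (P.pos c (m + 1) z) with hlt | hge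
          · exact ih' z hz hlt
          · rw [P.pos_step] at hpos
            split_ifs at hpos with h1 h2
            · right
              rw [← eq_west h1.2]
              exact hR c m hX
            · omega
            · exact absurd ⟨hX, by omega⟩ h2
        · rw [word_self_of_not hX]
          exact Or.inl (main m hcm hm hX ih' z hz hpos)
    have hcp : c ≤ P.pos c n y := (le_exitCol_iff hcn.le).1 hy.ge
    set p := P.pos c n y with hp
    have hpn : p < n := (P.pos_lt_iff c n y).2 hyn
    have hy1 : P.pos c (p + 1) y = p := by rw [P.pos_eq_start (by omega)]
    -- A pipe coming from the left into a crossing goes on to the next column, but `y` exits here.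
    have hX : ¬ P.IsCross c p := by
      intro hX
      have := hX.lt_exitCol_west
      rw [eq_west hy1] at this
      omega
    have := main p hcp hpn hX (inv (p + 1) (by omega) (by omega)) z hz
      (by rw [pos_of_not_isCross hX]; exact P.le_pos_of_le_start h)
    rwa [eq_west hy1] at this

/-- An inversion at the exit column of `y` would persist to the end, so `y` is still above `z`
there. -/
theorem IsIncreasing.rel_of_noninversion (hR : P.IsIncreasing) {R : ℕ → ℕ → Prop}
    (htrans : ∀ x y z, R x y → R y z → R x z) (harc : P.ContainsArcs R) {y z : ℕ} (hyz : y < z)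
    (hz : z < n) (h : P.exitCol y < P.exitCol z) : R y z := by
  refine hR.rel_of_above_at_exit htrans harc hz ?_
  have hyn := exitCol_lt (P := P).2 (hyz.trans hz)
  by_contra hc
  have hne : P.pos (P.exitCol y) n z ≠ P.pos (P.exitCol y) n y := fun he => by
    have := pos_injective he
    omega
  have := hR.inverted_mono hyz (by omega : P.pos (P.exitCol y) n z < P.pos (P.exitCol y) n y)
    le_rfl le_rfl (c' := n) (Or.inl hyn)
  rw [exitCol, exitCol] at h
  omega

/-- After the crossing the south pipe stays above the west pipe, in particular when it enters its
own, later, exit column. -/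
theorem IsIncreasing.rel_of_cross (hR : P.IsIncreasing) {R : ℕ → ℕ → Prop}
    (htrans : ∀ x y z, R x y → R y z → R x z) (harc : P.ContainsArcs R) {c m : ℕ}
    (hX : P.IsCross c m) (h : P.exitCol (P.south c m) ≠ c) : R (P.south c m) (P.west c m) := by
  have hlt := hX.lt
  refine hR.rel_of_above_at_exit htrans harc (west_lt hlt) ?_
  have := le_exitCol_south (P := P) hX.le hlt
  exact hR.inverted_mono (hR c m hX) (c := c) (m := m)
    (by rw [hX.pos_west, hX.pos_south]; omega) (by omega) le_rfl (by omega)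

/-- The boxes of a pipe dream are determined by any of its linear extensions. -/
theorem IsIncreasing.isCross_iff (hR : P.IsIncreasing) {q : ℕ → ℕ}
    (hq : P.ContainsArcs fun x y => q x < q y) {c m : ℕ} (hcm : c ≤ m) (hm : m + 1 < n) :
    P.IsCross c m ↔ P.west c m < P.south c m ∧
      (P.exitCol (P.south c m) = c ∨ q (P.south c m) < q (P.west c m)) := by
  constructor
  · intro hX
    refine ⟨hR c m hX, ?_⟩
    by_contra hc
    push Not at hc
    have := hR.rel_of_cross (R := fun x y => q x < q y) (fun x y z => lt_trans) hq hX hc.1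
    omega
  -- A contact would put the west pipe before the south pipe and send the south pipe to a later
  -- column, contradicting both alternatives.
  · rintro ⟨-, h2⟩
    by_contra hX
    have h3 := hq c m hcm hm hX
    have h4 := lt_exitCol_south hcm hm hX
    simp only at h3
    omega

end Filling

-- Existence and uniqueness of the pipe dream of a linear extension

variable {n : ℕ}

/-- The position of a letter in a permutation, extended by the identity to all natural numbers. -/
def rank (π : Equiv.Perm (Fin n)) (x : ℕ) : ℕ := if h : x < n then π.symm ⟨x, h⟩ else x

theorem rank_coe (π : Equiv.Perm (Fin n)) (i : Fin n) : rank π i = π.symm i := by simp [rank]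

theorem rank_lt_rank {π : Equiv.Perm (Fin n)} {i j : Fin n} :
    rank π i < rank π j ↔ π.symm i < π.symm j := by
  rw [rank_coe, rank_coe, Fin.lt_def]

theorem rank_lt (π : Equiv.Perm (Fin n)) {x : ℕ} (hx : x < n) : rank π x < n := by
  rw [rank, dif_pos hx]; exact Fin.is_lt _

theorem rank_injective {π : Equiv.Perm (Fin n)} {x y : ℕ} (hx : x < n) (hy : y < n)
    (h : rank π x = rank π y) : x = y := by
  rw [rank, rank, dif_pos hx, dif_pos hy] at h
  simpa using π.symm.injective (Fin.ext h)

theorem exists_rank_eq (π : Equiv.Perm (Fin n)) {p : ℕ} (hp : p < n) :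
    ∃ x < n, rank π x = p := ⟨π ⟨p, hp⟩, Fin.is_lt _, by rw [rank_coe]; simp⟩

theorem WeakLE.rank {π ω : Equiv.Perm (Fin n)} (h : WeakLE π ω) {x y : ℕ} (hxy : x < y)
    (hy : y < n) (hπ : rank π y < rank π x) : PipeDreams.rank ω y < PipeDreams.rank ω x := by
  have := h ⟨x, hxy.trans hy⟩ ⟨y, hy⟩ hxy (rank_lt_rank.1 hπ)
  exact rank_lt_rank.2 this

namespace Filling

variable {P P' : Filling n} {ω π : Equiv.Perm (Fin n)}

theorem hasExit_iff : P.HasExit ω ↔ ∀ x < n, P.exitCol x = rank ω x := by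
  constructor
  · intro h x hx
    have h1 := h (ω.symm ⟨x, hx⟩)
    rw [topPipe_zero, Equiv.apply_symm_apply] at h1
    have h2 := exitCol_word (P := P) (ω.symm ⟨x, hx⟩).is_lt
    rw [h1] at h2
    rw [h2, rank, dif_pos hx]
  · intro h c
    rw [topPipe_zero]
    exact word_eq_of_exitCol c.is_lt (by rw [h _ (Fin.is_lt _), rank_coe]; simp)

theorem contactArc_iff {i j : Fin n} : P.ContactArc i j ↔
    ∃ c m, c ≤ m ∧ m + 1 < n ∧ ¬ P.IsCross c m ∧ P.west c m = i ∧ P.south c m = j := by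
  constructor
  · rintro ⟨r, c, h1, h2, h3, h4⟩
    exact ⟨c, r + c, by omega, h1, by rwa [isCross_add], by rwa [← leftPipe_eq_west],
      by rwa [← bottomPipe_eq_south]⟩
  · rintro ⟨c, m, h1, h2, h3, h4, h5⟩
    obtain ⟨r, rfl⟩ : ∃ r, m = r + c := ⟨m - c, by omega⟩
    exact ⟨r, c, h2, by rwa [← isCross_add], by rwa [leftPipe_eq_west],
      by rwa [bottomPipe_eq_south]⟩

theorem containsArcs_iff {R : ℕ → ℕ → Prop} :
    P.ContainsArcs R ↔ ∀ i j : Fin n, P.ContactArc i j → R i j := by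
  constructor
  · intro h i j hij
    obtain ⟨c, m, h1, h2, h3, h4, h5⟩ := contactArc_iff.1 hij
    rw [← h4, ← h5]
    exact h c m h1 h2 h3
  · intro h c m h1 h2 h3
    exact h ⟨_, west_lt h2⟩ ⟨_, south_lt h2⟩ (contactArc_iff.2 ⟨c, m, h1, h2, h3, rfl, rfl⟩)

theorem isLinearExtension_iff :
    P.IsLinearExtension π ↔ P.ContainsArcs fun x y => rank π x < rank π y := by
  simp only [containsArcs_iff, rank_lt_rank]
  rfl

theorem IsLinearExtension.lt_of_contactLess (h : P.IsLinearExtension π) {i j : Fin n}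
    (hij : P.ContactLess i j) : π.symm i < π.symm j := by
  induction hij with
  | single h1 => exact h _ _ h1
  | tail _ h1 ih => exact ih.trans (h _ _ h1)

theorem IsLinearExtension.isAcyclic (h : P.IsLinearExtension π) : P.IsAcyclic :=
  fun _ hi => lt_irrefl _ (h.lt_of_contactLess hi)

/-- A pipe dream is determined by its exiting permutation and by any of its linear extensions. -/
theorem eq_of_isLinearExtension (hR : P.IsReduced) (hR' : P'.IsReduced) (hω : P.HasExit ω)
    (hω' : P'.HasExit ω) (hπ : P.IsLinearExtension π) (hπ' : P'.IsLinearExtension π) :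
    P = P' := by
  rw [isReduced_iff] at hR hR'
  rw [hasExit_iff] at hω hω'
  rw [isLinearExtension_iff] at hπ hπ'
  have hcross : ∀ c m, P.word c (m + 1) = P'.word c (m + 1) →
      (P.IsCross c m ↔ P'.IsCross c m) := by
    intro c m h
    by_cases hc : c ≤ m ∧ m + 1 < n
    · have hs := P.south_lt (c := c) hc.2
      have hs' := P'.south_lt (c := c) hc.2
      rw [hR.isCross_iff hπ hc.1 hc.2, hR'.isCross_iff hπ' hc.1 hc.2, hω _ hs, hω' _ hs']
      simp only [west, south, h]
    · constructor
      · exact fun hX => absurd ⟨hX.le, hX.lt⟩ hc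
      · exact fun hX => absurd ⟨hX.le, hX.lt⟩ hc
  have hstep : ∀ c m, P.word c (m + 1) = P'.word c (m + 1) → P.word c m = P'.word c m := by
    intro c m h
    rw [P.word_step, P'.word_step, h]
    by_cases hX : P.IsCross c m
    · rw [if_pos hX, if_pos ((hcross c m h).1 hX)]
    · rw [if_neg hX, if_neg fun hX' => hX ((hcross c m h).2 hX')]
  have hword : ∀ c m, m ≤ n → P.word c m = P'.word c m := fun c m hm =>
    column_induction (Q := fun c m => P.word c m = P'.word c m) (c := 0) (m := n)
      (fun c h => by rw [word_succ, word_succ, h]) (fun c m _ => hstep c m) le_rfl hm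
      (by omega) (by rw [word_zero, word_zero])
  have hcr : P.crosses = P'.crosses := by
    ext ⟨r, c⟩
    rw [← isCross_add, ← isCross_add]
    constructor
    · exact fun hX => (hcross c (r + c) (hword _ _ hX.lt.le)).1 hX
    · exact fun hX => (hcross c (r + c) (hword _ _ hX.lt.le)).2 hX
  cases P
  cases P'
  simpa using hcr

/-- The filling is built by the rule of `isCross_iff`, with the prescribed exits `rank ω` in place
of the actual ones. -/
theorem exists_isLinearExtension (h : WeakLE π ω) :
    ∃ P : Filling n, P.IsAcyclicPipeDream ω ∧ P.IsLinearExtension π := by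
  obtain ⟨P, hP⟩ := exists_isCross_iff (n := n) fun c m w => w m < w (m + 1) ∧
    (rank ω (w (m + 1)) = c ∨ rank π (w (m + 1)) < rank π (w m))
  change ∀ c m, P.IsCross c m ↔ c ≤ m ∧ m + 1 < n ∧ P.west c m < P.south c m ∧
    (rank ω (P.south c m) = c ∨ rank π (P.south c m) < rank π (P.west c m)) at hP
  have hne : ∀ c m, P.west c m ≠ P.south c m := by
    intro c m he
    have := P.pos_west c m
    rw [he, P.pos_south] at this
    omega
  -- Three joint invariants: pipes due earlier have left at the right place; the pipe due in column
  -- `c` is not left below the current box; inversions of the word are inversions of `ω`, and also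
  -- of `π` unless the larger label has exited or is on its way out in this column.
  have hinv : ∀ c m, m ≤ n → (∀ x < n, rank ω x < c → P.pos c m x = rank ω x) ∧
      (∀ x < n, rank ω x = c → P.pos c m x ≤ max c m) ∧
      (∀ x y, x < y → y < n → P.pos c m y < P.pos c m x → rank ω y < rank ω x ∧
        (rank π y < rank π x ∨ rank ω y < c ∨ rank ω y = c ∧ m ≤ P.pos c m y)) := by
    intro c m hm
    refine column_induction (Q := fun c m => (∀ x < n, rank ω x < c → P.pos c m x = rank ω x) ∧
      (∀ x < n, rank ω x = c → P.pos c m x ≤ max c m) ∧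
      (∀ x y, x < y → y < n → P.pos c m y < P.pos c m x → rank ω y < rank ω x ∧
        (rank π y < rank π x ∨ rank ω y < c ∨ rank ω y = c ∧ m ≤ P.pos c m y)))
      (c := 0) (m := n) ?_ ?_ le_rfl hm (by omega) ?_
    · rintro c ⟨h1, h2, h3⟩
      simp only [pos_succ]
      refine ⟨fun x hx hxc => ?_, fun x hx hxc => ?_, fun x y hxy hy hlt => ?_⟩
      · rcases Nat.lt_succ_iff_lt_or_eq.1 hxc with hc | hc
        · exact h1 x hx hc
        · have h4 := h2 x hx hc
          -- The due pipe ends the column at a position at most `c`. The positions below `c` belong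
          -- to the pipes already gone, so it is at `c`.
          by_contra hne'
          have hcn := rank_lt ω hx
          obtain ⟨y, hy, hyr⟩ := exists_rank_eq ω (show P.pos c 0 x < n by omega)
          have h5 := h1 y hy (by omega)
          rw [hyr] at h5
          have := pos_injective h5
          subst this
          omega
      · have := (P.pos_lt_iff c 0 x).2 hx
        omega
      · have := h3 x y hxy hy hlt
        omega
    · rintro c m hm ⟨h1, h2, h3⟩
      by_cases hX : P.IsCross c m
      · obtain ⟨hcm, hmn, hlt, hrule⟩ := (hP c m).1 hX
        have hsn := P.south_lt (c := c) hmn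
        have hwn := P.west_lt (c := c) hmn
        have hwc : c ≤ rank ω (P.west c m) := by
          by_contra hc
          have := h1 _ hwn (by omega)
          rw [P.pos_west] at this
          omega
        have hsc : c ≤ rank ω (P.south c m) := by
          by_contra hc
          have := h1 _ hsn (by omega)
          rw [P.pos_south] at this
          omega
        have hex : rank ω (P.south c m) < rank ω (P.west c m) := by
          rcases hrule with hr | hr
          · refine lt_of_le_of_ne (by omega) fun he => hne c m ?_
            exact (rank_injective hsn hwn he).symm
          · exact h.rank hlt hsn hr
        refine ⟨fun x hx hxc => ?_, fun x hx hxc => ?_, fun x y hxy hy hxy' => ?_⟩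
        · have := h1 x hx hxc
          rw [P.pos_step, if_neg (by omega), if_neg (by omega), this]
        · have h4 := h2 x hx hxc
          have h5 : P.pos c (m + 1) x ≠ m := fun he => by
            rw [eq_west he] at hex
            omega
          rw [P.pos_step]
          split_ifs with h6 h7
          · exact absurd h6.2 h5
          · omega
          · have : P.pos c (m + 1) x ≠ m + 1 := fun he => h7 ⟨hX, he⟩
            omega
        · rcases lt_or_cross_of_lt_after hxy' with h4 | ⟨-, h4, h5⟩
          · obtain ⟨h5, h6⟩ := h3 x y hxy hy h4
            refine ⟨h5, ?_⟩
            rcases h6 with h6 | h6 | h6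
            · exact Or.inl h6
            · exact Or.inr (Or.inl h6)
            · refine Or.inr (Or.inr ⟨h6.1, ?_⟩)
              rw [P.pos_step]
              split_ifs <;> omega
          · subst h4 h5
            refine ⟨hex, ?_⟩
            rw [hX.pos_south]
            omega
      · simp only [pos_of_not_isCross hX]
        refine ⟨h1, fun x hx hxc => ?_, fun x y hxy hy hxy' => ?_⟩
        · have h4 := h2 x hx hxc
          by_contra hc
          have hxm : P.pos c (m + 1) x = m + 1 := by omega
          have hmn : m + 1 < n := by
            have := (P.pos_lt_iff c (m + 1) x).2 hx
            omega
          have hwn := P.west_lt (c := c) hmn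
          have hs := eq_south hxm
          -- If the due pipe `x` met a contact from below, the rule would force a larger west label.
          -- That pair would be an inversion, so the west pipe would be due before column `c` and
          -- could not be at position `m`.
          have h5 : ¬ P.west c m < x := fun hlt =>
            hX ((hP c m).2 ⟨by omega, hmn, by rwa [hs], by rw [hs]; exact Or.inl hxc⟩)
          have h6 := hne c m
          rw [hs] at h6
          have h7 := h3 x (P.west c m) (by omega) hwn (by rw [P.pos_west, hxm]; omega)
          have h8 := h1 _ hwn (by omega)
          rw [P.pos_west] at h8
          omega
        · have := h3 x y hxy hy hxy'
          omega
    · simp only [pos_zero]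
      refine ⟨fun x _ hx => by omega, fun x hx _ => by omega, fun x y hxy _ hlt => by omega⟩
  have hlin : P.IsLinearExtension π := by
    rw [isLinearExtension_iff]
    intro c m hcm hmn hX
    obtain ⟨h1, -, h3⟩ := hinv c (m + 1) hmn.le
    have hsn := P.south_lt (c := c) hmn
    have hwn := P.west_lt (c := c) hmn
    rcases lt_or_gt_of_ne (hne c m) with hlt | hgt
    · have h4 : rank π (P.west c m) ≠ rank π (P.south c m) := fun he =>
        hne c m (rank_injective hwn hsn he)
      by_contra hc
      exact hX ((hP c m).2 ⟨hcm, hmn, hlt, Or.inr (by omega)⟩)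
    -- A contact of an already inverted pair: the west pipe has not exited, and at position `m` it
    -- is not carried from below, so the third invariant leaves only the inversion in `π`.
    · have h4 := h3 _ _ hgt hwn (by rw [P.pos_west, P.pos_south]; omega)
      rw [P.pos_west] at h4
      have h5 : ¬ rank ω (P.west c m) < c := fun hc => by
        have := h1 _ hwn hc
        rw [P.pos_west] at this
        omega
      omega
  refine ⟨P, ⟨?_, ?_, hlin.isAcyclic⟩, hlin⟩
  · rw [isReduced_iff]
    exact fun c m hX => ((hP c m).1 hX).2.2.1
  · rw [hasExit_iff]
    exact fun x hx => (hinv n n le_rfl).1 x hx (rank_lt ω hx)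

/-- The linear extensions of a pipe dream are below its exiting permutation. -/
theorem IsLinearExtension.weakLE (hR : P.IsReduced) (hω : P.HasExit ω)
    (hπ : P.IsLinearExtension π) : WeakLE π ω := by
  rw [isReduced_iff] at hR
  rw [hasExit_iff] at hω
  rw [isLinearExtension_iff] at hπ
  intro i j hij h
  by_contra hc
  have hne : ω.symm i ≠ ω.symm j := fun he => hij.ne (ω.symm.injective he)
  have h1 : ω.symm i < ω.symm j := by omega
  have h2 := hR.rel_of_noninversion (R := fun x y => rank π x < rank π y)
    (fun x y z => lt_trans) hπ hij j.is_lt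
    (by rw [hω _ i.is_lt, hω _ j.is_lt]; exact rank_lt_rank.2 h1)
  exact lt_asymm h (rank_lt_rank.1 h2)

theorem contactLess_of_noninversion (hR : P.IsReduced) (hω : P.HasExit ω) {i j : Fin n}
    (hij : i < j) (h : ω.symm i < ω.symm j) : P.ContactLess i j := by
  rw [isReduced_iff] at hR
  rw [hasExit_iff] at hω
  have h2 := hR.rel_of_noninversion (R := fun x y => ∃ (hx : x < n) (hy : y < n),
      P.ContactLess ⟨x, hx⟩ ⟨y, hy⟩)
    (fun x y z ⟨hx, _, h1⟩ ⟨_, hz, h2⟩ => ⟨hx, hz, h1.trans h2⟩)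
    (containsArcs_iff.2 fun i j hij => ⟨i.is_lt, j.is_lt, .single hij⟩) hij j.is_lt
    (by rw [hω _ i.is_lt, hω _ j.is_lt]; exact rank_lt_rank.2 h)
  exact h2.2.2

end Filling

-- Counting criterion for a contact of consecutive pipes

namespace Filling

variable {n : ℕ} {P : Filling n} {q : ℕ → ℕ}

/-- Going up, a crossing keeps the carried pipe and a contact replaces it by one which precedes it.
-/
theorem carry_anti (hq : P.ContainsArcs fun x y => q x < q y) {c m m' : ℕ} (hcm : c ≤ m')
    (hle : m' ≤ m) (hm : m < n) : q (P.word c m' m') ≤ q (P.word c m m) := by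
  induction hle using Nat.decreasingInduction with
  | self => rfl
  | of_succ k hk ih =>
    refine le_trans ?_ (ih (by omega))
    by_cases hX : P.IsCross c k
    · rw [hX.word_self, south]
    · rw [word_self_of_not hX]
      exact (hq c k hcm (by omega) hX).le

/-- If the exiting pipe of a column is among the first pipes of a linear extension, then the carried
pipe is among them above all boxes which are above one of them. -/
theorem IsIncreasing.carry_lt_or_pos_lt (hR : P.IsIncreasing)
    (hq : P.ContainsArcs fun x y => q x < q y) {c k s : ℕ} (hc : c < n) (hk : k < n)
    (hks : q k < s) (hs : q (P.word c c c) < s) {m : ℕ} (hcm : c ≤ m) (hm : m ≤ n) :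
    q (P.word c m m) < s ∨ P.pos c m k < m := by
  induction hm using Nat.decreasingInduction with
  | self => exact Or.inr ((P.pos_lt_iff c n k).2 hk)
  | of_succ m hm ih =>
    have hkn := (P.pos_lt_iff c (m + 1) k).2 hk
    have ih := ih (by omega)
    have hlow : P.pos c (m + 1) k < m → P.pos c m k < m := fun h => by
      rw [P.pos_step, if_neg (by omega), if_neg (by omega)]; exact h
    by_cases hX : P.IsCross c m
    · rw [hX.word_self]
      rcases ih with ih | ih
      · exact Or.inl ih
      · rcases Nat.lt_succ_iff_lt_or_eq.1 ih with h | h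
        · exact Or.inr (hlow h)
        · left
          obtain ⟨-, h1 | h1⟩ := (hR.isCross_iff hq hcm hX.lt).1 hX
          · rwa [word_eq_of_exitCol hc h1] at hs
          · rw [eq_west h] at h1
            omega
    · rw [word_self_of_not hX]
      have hlt : P.pos c (m + 1) k < m + 1 → q (P.west c m) < s ∨ P.pos c m k < m := fun h => by
        rcases Nat.lt_succ_iff_lt_or_eq.1 h with h | h
        · exact Or.inr (hlow h)
        · left; rwa [eq_west h]
      -- The last antidiagonal holds no contact: the only pipe of the box becomes the carried one.
      by_cases hmn : m + 1 < n
      · rcases ih with ih | ih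
        · exact Or.inl ((hq c m hcm hmn hX).trans ih)
        · exact hlt ih
      · exact hlt (by omega)

/-- In a column in which `y` does not exit, `y` does not cross the pipes above it which precede it
in a linear extension. -/
theorem IsIncreasing.above_of_above (hR : P.IsIncreasing)
    (hq : P.ContainsArcs fun x y => q x < q y) {c x y : ℕ} (hxy : q x < q y)
    (hy : P.exitCol y ≠ c) (h : P.pos c n x < P.pos c n y) :
    P.pos (c + 1) n x < P.pos (c + 1) n y := by
  simp only [pos_succ]
  have key : ∀ m, m ≤ n → P.pos c m x < P.pos c m y := by
    intro m hm
    induction hm using Nat.decreasingInduction with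
    | self => exact h
    | of_succ m hm ih =>
      rcases lt_or_cross_of_lt ih with h1 | ⟨hX, h2, h3⟩
      · exact h1
      · have := ((hR.isCross_iff hq hX.le hX.lt).1 hX).2
        rw [h2, h3] at this
        omega
  exact key 0 (Nat.zero_le n)

/-- A pipe is the west pipe of only one box of a column, in the row where it enters. Only there can
a pipe from below overtake it. -/
theorem cross_of_not_above {c x y : ℕ} (h : P.pos c n x < P.pos c n y)
    (h' : ¬ P.pos (c + 1) n x < P.pos (c + 1) n y) :
    P.IsCross c (P.pos c n x) ∧ P.south c (P.pos c n x) = y := by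
  by_contra hc
  refine h' ?_
  simp only [pos_succ]
  have key : ∀ m, m ≤ n → P.pos c m x < P.pos c m y := by
    intro m hm
    induction hm using Nat.decreasingInduction with
    | self => exact h
    | of_succ m hm ih =>
      rcases lt_or_cross_of_lt ih with h1 | ⟨hX, h2, h3⟩
      · exact h1
      · exfalso
        have h4 : P.pos c (m + 1) x = m := by rw [← h2, P.pos_west]
        have h5 : P.pos c n x < m + 1 := by
          by_contra h6
          have := P.le_pos_of_le_start (c := c) (m := m + 1) (x := x) (by omega)
          omega
        have h6 : P.pos c n x = m := by rw [← P.pos_eq_start h5, h4]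
        rw [h6] at hc
        exact hc ⟨hX, h3⟩
  exact key 0 (Nat.zero_le n)

open Classical in
/-- The pipes preceding `i` in a linear extension and below `i` at the start of a column. -/
noncomputable def belowBefore (P : Filling n) (q : ℕ → ℕ) (i c : ℕ) : Finset ℕ :=
  {k ∈ range n | q k < q i ∧ P.pos c n i < P.pos c n k}

open Classical in
/-- The pipes preceding `i` in a linear extension which exit before a column. -/
noncomputable def exitBefore (P : Filling n) (q : ℕ → ℕ) (i c : ℕ) : Finset ℕ :=
  {k ∈ range n | q k < q i ∧ P.exitCol k < c}

theorem mem_belowBefore {i c k : ℕ} :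
    k ∈ P.belowBefore q i c ↔ k < n ∧ q k < q i ∧ P.pos c n i < P.pos c n k := by
  simp [belowBefore]

theorem mem_exitBefore {i c k : ℕ} :
    k ∈ P.exitBefore q i c ↔ k < n ∧ q k < q i ∧ P.exitCol k < c := by
  simp [exitBefore]

theorem word_self_lt {c : ℕ} (hc : c < n) : P.word c c c < n := (P.word_lt_iff c c c).2 hc

theorem card_exitBefore_succ {i c : ℕ} (hc : c < n) : #(P.exitBefore q i (c + 1)) =
    #(P.exitBefore q i c) + if q (P.word c c c) < q i then 1 else 0 := by
  have hex := exitCol_word (P := P) hc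
  split_ifs with h
  · rw [← card_insert_of_notMem (a := P.word c c c) (by rw [mem_exitBefore]; omega)]
    congr 1
    ext k
    rw [mem_insert, mem_exitBefore, mem_exitBefore]
    constructor
    · rintro ⟨h1, h2, h3⟩
      rcases Nat.lt_succ_iff_lt_or_eq.1 h3 with h4 | h4
      · exact Or.inr ⟨h1, h2, h4⟩
      · exact Or.inl (word_eq_of_exitCol hc h4).symm
    · rintro (rfl | ⟨h1, h2, h3⟩)
      · exact ⟨word_self_lt hc, h, by omega⟩
      · exact ⟨h1, h2, by omega⟩
  · rw [add_zero]
    congr 1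
    ext k
    rw [mem_exitBefore, mem_exitBefore]
    constructor
    · rintro ⟨h1, h2, h3⟩
      rcases Nat.lt_succ_iff_lt_or_eq.1 h3 with h4 | h4
      · exact ⟨h1, h2, h4⟩
      · rw [← word_eq_of_exitCol hc h4] at h2
        exact absurd h2 h
    · rintro ⟨h1, h2, h3⟩
      exact ⟨h1, h2, by omega⟩

theorem exitBefore_mono {i c c' : ℕ} (h : c ≤ c') :
    P.exitBefore q i c ⊆ P.exitBefore q i c' := by
  intro k
  rw [mem_exitBefore, mem_exitBefore]
  omega

/-- Only the pipe crossing `i` from below can leave the set, so at most one does. That pipe is then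
the carried pipe, so by `carry_anti` the pipe exiting in the column precedes or equals it; a loss
thus forces the exiting pipe to precede `i`. -/
theorem card_belowBefore_le (hq : P.ContainsArcs fun x y => q x < q y) {i c : ℕ} :
    #(P.belowBefore q i c) ≤
      #(P.belowBefore q i (c + 1)) + if q (P.word c c c) < q i then 1 else 0 := by
  split_ifs with h
  · refine le_trans (card_le_card (t := insert (P.south c (P.pos c n i))
      (P.belowBefore q i (c + 1))) fun k hk => ?_) (card_insert_le _ _)
    rw [mem_belowBefore] at hk
    rw [mem_insert, mem_belowBefore]
    by_cases h1 : P.pos (c + 1) n i < P.pos (c + 1) n k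
    · exact Or.inr ⟨hk.1, hk.2.1, h1⟩
    · exact Or.inl (cross_of_not_above hk.2.2 h1).2.symm
  · rw [add_zero]
    refine card_le_card fun k hk => ?_
    rw [mem_belowBefore] at hk ⊢
    refine ⟨hk.1, hk.2.1, ?_⟩
    by_contra h1
    obtain ⟨hX, h2⟩ := cross_of_not_above hk.2.2 h1
    have h3 := carry_anti hq le_rfl hX.le (by have := hX.lt; omega)
    rw [hX.word_self, h2] at h3
    omega

/-- No pipe enters the set, by `above_of_above`. If the exiting pipe precedes `i`, then `i` must
enter through a crossing: a contact would have a south pipe strictly after `i` and, since `j` is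
below, at most `j`, hence equal to `j`. The pipe crossing `i` precedes it and leaves the set. -/
theorem IsIncreasing.card_belowBefore_ge (hR : P.IsIncreasing)
    (hq : P.ContainsArcs fun x y => q x < q y)
    (hinj : ∀ x < n, ∀ y < n, q x = q y → x = y) {i j c : ℕ} (hj : j < n)
    (hij : q j = q i + 1) (hic : c < P.exitCol i) (hc : c < n)
    (harc : ∀ c m, c ≤ m → m + 1 < n → ¬ P.IsCross c m → P.west c m = i → P.south c m ≠ j)
    (habove : P.pos c n i < P.pos c n j) :
    #(P.belowBefore q i (c + 1)) + (if q (P.word c c c) < q i then 1 else 0) ≤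
      #(P.belowBefore q i c) := by
  have hsub : P.belowBefore q i (c + 1) ⊆ P.belowBefore q i c := by
    intro k hk
    rw [mem_belowBefore] at hk ⊢
    refine ⟨hk.1, hk.2.1, ?_⟩
    by_contra h1
    have h2 : P.pos c n k ≠ P.pos c n i := fun he => by
      have := pos_injective he
      subst this
      omega
    have := hR.above_of_above hq hk.2.1 hic.ne' (lt_of_le_of_ne (not_lt.1 h1) h2)
    omega
  split_ifs with h
  · set p := P.pos c n i with hp
    have hcp : c ≤ p := (le_exitCol_iff hc.le).1 hic.le
    have hjn := (P.pos_lt_iff c n j).2 hj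
    have hw : P.west c p = i := eq_west (by rw [P.pos_eq_start (by omega)])
    have hsn := P.south_lt (c := c) (m := p) (by omega)
    have hX : IsCross P c p := by
      by_contra hX
      have h1 := P.le_pos_of_le_start (c := c) (m := p + 1) (x := j) habove
      have h2 := hq c p hcp (by omega) hX
      -- The threshold `q j + 1` means "at most `j`"; as `j` is below the box, the pipe carried into
      -- it satisfies this bound.
      rcases hR.carry_lt_or_pos_lt hq hc hj (Nat.lt_succ_self (q j)) (by omega)
        (m := p + 1) (by omega) (by omega) with h3 | h3
      · simp only [hw] at h2
        have h4 : q (P.south c p) < q j + 1 := h3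
        exact harc c p hcp (by omega) hX hw (hinj _ hsn _ hj (by omega))
      · omega
    have hb : q (P.south c p) < q i := by
      rcases ((hR.isCross_iff hq hcp hX.lt).1 hX).2 with h1 | h1
      · rwa [← word_eq_of_exitCol hc h1]
      · rwa [hw] at h1
    have hbpos : P.pos c n i < P.pos c n (P.south c p) := by
      by_contra h1
      have h2 := P.pos_eq_start (c := c) (m := p + 1) (x := P.south c p) (by omega)
      rw [P.pos_south] at h2
      omega
    have hbmem : P.south c p ∈ P.belowBefore q i c := mem_belowBefore.2 ⟨hsn, hb, hbpos⟩
    have hnot : P.south c p ∉ P.belowBefore q i (c + 1) := by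
      rw [mem_belowBefore]
      rintro ⟨-, -, h1⟩
      simp only [pos_succ] at h1
      have h2 := hX.pos_west
      rw [hw] at h2
      rw [P.pos_eq_of_lt (m := p) (x := i) (by omega) (by omega), h2] at h1
      have h3 := P.pos_le_of_le (hX.pos_south.le) (Nat.zero_le p)
      omega
    have := card_lt_card (Finset.ssubset_iff_subset_ne.2 ⟨hsub, fun he => hnot (he ▸ hbmem)⟩)
    omega
  · simpa using card_le_card hsub

/-- Two pipes which are consecutive in a linear extension and cross each other have a contact if and
only if among the preceding pipes fewer enter below `i` than exit to the left of `j`. -/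
theorem IsIncreasing.exists_contact_iff (hR : P.IsIncreasing)
    (hq : P.ContainsArcs fun x y => q x < q y)
    (hinj : ∀ x < n, ∀ y < n, q x = q y → x = y) {i j : ℕ} (hlt : i < j) (hj : j < n)
    (hij : q j = q i + 1) (he : P.exitCol j < P.exitCol i) :
    (∃ c m, c ≤ m ∧ m + 1 < n ∧ ¬ P.IsCross c m ∧ P.west c m = i ∧ P.south c m = j) ↔
      #{k ∈ range n | q k < q i ∧ i < k} <
        #{k ∈ range n | q k < q i ∧ P.exitCol k < P.exitCol j} := by
  have hA : ({k ∈ range n | q k < q i ∧ i < k} : Finset ℕ) = P.belowBefore q i 0 := by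
    ext k; simp [mem_belowBefore, pos_zero]
  have hB : ({k ∈ range n | q k < q i ∧ P.exitCol k < P.exitCol j} : Finset ℕ) =
      P.exitBefore q i (P.exitCol j) := by
    ext k; simp [mem_exitBefore]
  have hB0 : #(P.exitBefore q i 0) = 0 := by
    rw [card_eq_zero]; ext k; simp [mem_exitBefore]
  have hejn := exitCol_lt (P := P).2 hj
  rw [hA, hB]
  constructor
  · rintro ⟨c, m, hcm, hmn, hX, rfl, rfl⟩
    have hcj := lt_exitCol_south hcm hmn hX
    have hc : c < n := by omega
    -- Each loss below `i` is paid for by an exit of a preceding pipe.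
    have hle : ∀ d, d ≤ n → #(P.belowBefore q (P.west c m) 0) ≤
        #(P.belowBefore q (P.west c m) d) + #(P.exitBefore q (P.west c m) d) := by
      intro d hd
      induction d with
      | zero => omega
      | succ d ih =>
        have h1 := ih (by omega)
        have h2 := card_belowBefore_le hq (i := P.west c m) (c := d)
        have h3 := card_exitBefore_succ (P := P) (q := q) (i := P.west c m) (c := d) (by omega)
        omega
    have h1 := hle c hc.le
    have hstart : P.pos c n (P.west c m) < m + 1 := by
      by_contra h2
      have := P.le_pos_of_le_start (not_lt.1 h2)
      rw [P.pos_west] at this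
      omega
    have hstart' : P.pos c n (P.west c m) = m := by
      rw [← P.pos_eq_start hstart, P.pos_west]
    have hwn := P.west_lt (c := c) hmn
    have hω : q (P.word c c c) < q (P.west c m) := by
      have h2 := carry_anti hq le_rfl hcm (by omega)
      rw [word_self_of_not hX] at h2
      refine lt_of_le_of_ne h2 fun h3 => ?_
      have h4 := hinj _ (word_self_lt hc) _ hwn h3
      have h5 := exitCol_word (P := P) hc
      rw [h4] at h5
      omega
    -- A preceding pipe below `i` would force the pipe carried into the contact to precede `i`, but
    -- that pipe is `j`. So the supply is exhausted, and the exit of column `c` itself, still before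
    -- that of `j`, makes the inequality strict.
    have hD : P.belowBefore q (P.west c m) c = ∅ := by
      rw [eq_empty_iff_forall_notMem]
      intro k hk
      obtain ⟨h2, h3, h4⟩ := mem_belowBefore.1 hk
      have h5 := P.le_pos_of_le_start (c := c) (m := m + 1) (x := k) (by omega)
      rcases hR.carry_lt_or_pos_lt hq hc h2 h3 hω (m := m + 1) (by omega) (by omega) with h6 | h6
      · change q (P.south c m) < _ at h6
        omega
      · omega
    have h2 := card_exitBefore_succ (P := P) (q := q) (i := P.west c m) hc
    rw [if_pos hω] at h2
    have h3 := card_le_card (P.exitBefore_mono (q := q) (i := P.west c m) (Nat.succ_le_of_lt hcj))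
    rw [Nat.succ_eq_add_one] at h3
    rw [hD, card_empty] at h1
    omega
  · intro hAB
    by_contra hno
    push Not at hno
    -- Without a contact, `i` stays above `j` until the exit column of `j`, and every exit of a
    -- preceding pipe before it costs one pipe below `i`.
    have key : ∀ c, c ≤ P.exitCol j → P.pos c n i < P.pos c n j ∧
        #(P.belowBefore q i c) + #(P.exitBefore q i c) ≤ #(P.belowBefore q i 0) := by
      intro c hc
      induction c with
      | zero => simp only [pos_zero]; omega
      | succ c ih =>
        obtain ⟨h1, h2⟩ := ih (by omega)
        refine ⟨hR.above_of_above hq (by omega) (by omega) h1, ?_⟩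
        have h3 := hR.card_belowBefore_ge hq hinj hj hij (c := c) (by omega) (by omega) hno h1
        have h4 := card_exitBefore_succ (P := P) (q := q) (i := i) (c := c) (by omega)
        omega
    have := (key _ le_rfl).2
    omega

end Filling

-- Adjacent exchanges and patterns

variable {n : ℕ} {ω π σ : Equiv.Perm (Fin n)} {p q : Fin n}

theorem swap_symm_apply (k : Fin n) :
    (π * Equiv.swap p q).symm k = Equiv.swap p q (π.symm k) := by
  rw [Equiv.symm_apply_eq, Equiv.Perm.mul_apply, Equiv.swap_apply_self, Equiv.apply_symm_apply]

theorem swap_symm_lt_iff (hpq : (p : ℕ) + 1 = q) {x y : Fin n} (h : ¬ (x = π p ∧ y = π q))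
    (h' : ¬ (x = π q ∧ y = π p)) :
    (π * Equiv.swap p q).symm x < (π * Equiv.swap p q).symm y ↔ π.symm x < π.symm y := by
  rw [swap_symm_apply, swap_symm_apply]
  rw [← Equiv.symm_apply_eq, ← Equiv.symm_apply_eq] at h h'
  rw [Equiv.swap_apply_def, Equiv.swap_apply_def]
  simp only [Fin.ext_iff] at *
  split_ifs <;> simp only [Fin.lt_def] <;> omega

theorem swap_symm_left : (π * Equiv.swap p q).symm (π p) = q := by
  rw [swap_symm_apply]; simp

theorem swap_symm_right : (π * Equiv.swap p q).symm (π q) = p := by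
  rw [swap_symm_apply]; simp

theorem lettersBefore_swap (hpq : (p : ℕ) + 1 = q) :
    lettersBefore (π * Equiv.swap p q) p = lettersBefore π p := by
  ext k
  simp only [lettersBefore, mem_filter, mem_univ, true_and, swap_symm_apply,
    Equiv.swap_apply_def]
  simp only [Fin.lt_def]
  split_ifs with h1 h2
  · rw [h1]; omega
  · rw [h2]; omega
  · rfl

theorem weakLE_swap_of_lt (hpq : (p : ℕ) + 1 = q) (h : π p < π q) :
    WeakLE π (π * Equiv.swap p q) := by
  intro i j hij hji
  by_cases h1 : j = π p ∧ i = π q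
  · rw [h1.1, h1.2] at hij
    exact absurd hij h.not_gt
  · by_cases h2 : j = π q ∧ i = π p
    · rw [h2.1, h2.2, swap_symm_right, swap_symm_left, Fin.lt_def]
      omega
    · exact (swap_symm_lt_iff hpq h1 h2).2 hji

theorem weakLE_of_swap_of_lt (hpq : (p : ℕ) + 1 = q) (h : π q < π p) :
    WeakLE (π * Equiv.swap p q) π := by
  have h1 := weakLE_swap_of_lt (π := π * Equiv.swap p q) hpq (by simpa using h)
  rwa [mul_assoc, Equiv.swap_mul_self, mul_one] at h1

theorem eq_of_forall_adjacent
    (h : ∀ p q : Fin n, (p : ℕ) + 1 = q → σ.symm (π p) < σ.symm (π q)) : π = σ := by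
  have hmono : StrictMono fun p => σ.symm (π p) := by
    cases n with
    | zero => exact fun p => p.elim0
    | succ n =>
      rw [Fin.strictMono_iff_lt_succ]
      exact fun p => h _ _ (by simp)
  have key : ∀ x y, π.symm x < π.symm y ↔ σ.symm x < σ.symm y := by
    intro x y
    have := hmono.lt_iff_lt (a := π.symm x) (b := π.symm y)
    simpa using this.symm
  exact WeakLE.antisymm (fun i j _ hji => (key _ _).1 hji) fun i j _ hji => (key _ _).2 hji

theorem card_range_filter (f : ℕ → Prop) [DecidablePred f] :
    #{k ∈ range n | f k} = #{k : Fin n | f k} := by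
  rw [← card_map Fin.valEmbedding]
  congr 1
  ext k
  simp only [mem_filter, mem_range, mem_map, mem_univ, true_and, Fin.valEmbedding_apply]
  constructor
  · rintro ⟨h1, h2⟩
    exact ⟨⟨k, h1⟩, h2, rfl⟩
  · rintro ⟨k, h1, rfl⟩
    exact ⟨k.is_lt, h1⟩

theorem hasLargeSubwordBefore_iff_card {i j : Fin n} : HasLargeSubwordBefore ω π p i j ↔
    #{k : Fin n | k ≤ i ∧ ω.symm k < ω.symm j} ≤
      #{k ∈ lettersBefore π p | i < k ∧ ω.symm j < ω.symm k} := by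
  have hcard : #{k ∈ lettersBefore π p | i < k ∧ ω.symm j < ω.symm k} =
      #{t : Fin n | t < p ∧ i < π t ∧ ω.symm j < ω.symm (π t)} := by
    rw [← card_map π.symm.toEmbedding]
    congr 1
    ext t
    simp only [lettersBefore, mem_map_equiv, mem_filter, mem_univ, true_and, Equiv.symm_symm,
      Equiv.symm_apply_apply]
  rw [hcard]
  constructor
  · rintro ⟨s, hs, h⟩
    rw [← card_fin #{k : Fin n | k ≤ i ∧ ω.symm k < ω.symm j},
      ← card_image_of_injective _ hs.injective]
    refine card_le_card fun t ht => ?_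
    obtain ⟨a, -, rfl⟩ := mem_image.1 ht
    simpa using h a
  · intro h
    refine ⟨_, (orderEmbOfCardLe _ h).strictMono, fun t => ?_⟩
    simpa using orderEmbOfCardLe_mem _ h t

/-- The letters `k > i` with `ω⁻¹(k) < ω⁻¹(j)` count on both sides and cancel. What remains on the
right are the `k ≤ i` with `ω⁻¹(k) < ω⁻¹(j)`; these are non-inversions with `j`, so all of them
precede `j` in `π` and none is lost by restricting to `U`. The hypotheses `hj` and `hL` cover both
orders of `i` and `j` at the positions following `U`. -/
theorem hasLargeSubwordBefore_iff (hπ : WeakLE π ω) {i j : Fin n} (hij : i < j)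
    (he : ω.symm j < ω.symm i) (hj : p ≤ π.symm j)
    (hL : ∀ k ≠ i, π.symm k < π.symm j → π.symm k < p) :
    HasLargeSubwordBefore ω π p i j ↔ #{k ∈ lettersBefore π p | i < k} ≥
      #{k ∈ lettersBefore π p | ω.symm k < ω.symm j} := by
  have h1 := card_filter_add_card_filter_not (s := {k ∈ lettersBefore π p | i < k})
    (fun k => ω.symm k < ω.symm j)
  have h2 := card_filter_add_card_filter_not
    (s := {k ∈ lettersBefore π p | ω.symm k < ω.symm j}) (fun k => i < k)
  simp only [filter_filter] at h1 h2
  have h3 : ({k ∈ lettersBefore π p | i < k ∧ ¬ ω.symm k < ω.symm j} : Finset (Fin n)) =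
      {k ∈ lettersBefore π p | i < k ∧ ω.symm j < ω.symm k} := by
    refine filter_congr fun k hk => ?_
    have hkp : π.symm k < p := by simpa [lettersBefore] using hk
    have hne : ω.symm k ≠ ω.symm j := fun h => by
      rw [ω.symm.injective h] at hkp
      exact absurd hkp hj.not_gt
    omega
  have h4 : ({k ∈ lettersBefore π p | ω.symm k < ω.symm j ∧ ¬ i < k} : Finset (Fin n)) =
      ({k : Fin n | k ≤ i ∧ ω.symm k < ω.symm j} : Finset (Fin n)) := by
    ext k
    simp only [lettersBefore, mem_filter, mem_univ, true_and, not_lt]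
    constructor
    · exact fun h => ⟨h.2.2, h.2.1⟩
    · rintro ⟨hki, hkj⟩
      refine ⟨hL k ?_ ?_, hkj, hki⟩
      · rintro rfl
        exact lt_asymm he hkj
      · by_contra hc
        have hne : π.symm j ≠ π.symm k := fun h => by
          rw [π.symm.injective h] at hkj
          exact lt_irrefl _ hkj
        have := hπ k j (hki.trans_lt hij) (lt_of_le_of_ne (not_lt.1 hc) hne)
        exact lt_asymm this hkj
  have h5 : ({k ∈ lettersBefore π p | ω.symm k < ω.symm j ∧ i < k} : Finset (Fin n)) =
      {k ∈ lettersBefore π p | i < k ∧ ω.symm k < ω.symm j} := by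
    simp only [and_comm]
  rw [hasLargeSubwordBefore_iff_card, ← h3, ← h4]
  rw [h5] at h2
  omega

-- Exchanges between linear extensions

namespace Filling

variable {P : Filling n}

/-- Consecutive letters without contact can be exchanged. -/
theorem IsLinearExtension.swap (h : P.IsLinearExtension π) (hpq : (p : ℕ) + 1 = q)
    (hno : ¬ P.ContactArc (π p) (π q)) : P.IsLinearExtension (π * Equiv.swap p q) := by
  intro x y hxy
  have h1 := h x y hxy
  refine (swap_symm_lt_iff hpq ?_ ?_).2 h1
  · rintro ⟨rfl, rfl⟩
    exact hno hxy
  · rintro ⟨rfl, rfl⟩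
    simp only [Equiv.symm_apply_apply, Fin.lt_def] at h1
    omega

theorem not_contactArc_iff_swapCondition (hR : P.IsReduced) (hω : P.HasExit ω)
    (hπ : P.IsLinearExtension π) (hpq : (p : ℕ) + 1 = q) (hlt : π p < π q)
    (he : ω.symm (π q) < ω.symm (π p)) :
    ¬ P.ContactArc (π p) (π q) ↔ SwapCondition ω π p q := by
  rw [isReduced_iff] at hR
  rw [hasExit_iff] at hω
  rw [isLinearExtension_iff] at hπ
  have h := hR.exists_contact_iff hπ (fun x hx y hy => rank_injective hx hy) hlt (π q).is_lt
    (by simp [rank_coe, hpq])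
    (by rw [hω _ (Fin.is_lt _), hω _ (Fin.is_lt _)]; exact rank_lt_rank.2 he)
  rw [contactArc_iff, h, card_range_filter, card_range_filter, not_lt, SwapCondition, ge_iff_le]
  have h1 : ∀ k : Fin n, P.exitCol k = rank ω k := fun k => hω k k.is_lt
  simp only [h1, rank_lt_rank, lettersBefore, filter_filter, Equiv.symm_apply_apply, Fin.val_fin_lt]

/-- Two linear extensions of a pipe dream are related by exchanges of consecutive letters. -/
theorem exists_swap_toward (hπ : P.IsLinearExtension π) (hσ : P.IsLinearExtension σ)
    (hne : π ≠ σ) : ∃ p q : Fin n, (p : ℕ) + 1 = q ∧ σ.symm (π q) < σ.symm (π p) ∧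
      P.IsLinearExtension (π * Equiv.swap p q) := by
  by_contra! hc
  refine hne (eq_of_forall_adjacent fun p q hpq => ?_)
  by_contra hlt
  have h1 : σ.symm (π q) ≠ σ.symm (π p) := fun h => by
    have := π.injective (σ.symm.injective h)
    omega
  have h2 := lt_of_le_of_ne (not_lt.1 hlt) h1
  exact hc p q hpq h2 (hπ.swap hpq fun harc => hlt (hσ _ _ harc))

/-- Two incomparable pipes are consecutive in some linear extension. -/
theorem exists_adjacent_linearExtension (hA : P.IsAcyclic) {i j : Fin n} (hij : i ≠ j)
    (h1 : ¬ P.ContactLess i j) (h2 : ¬ P.ContactLess j i) :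
    ∃ π : Equiv.Perm (Fin n), P.IsLinearExtension π ∧ (π.symm i : ℕ) + 1 = π.symm j := by
  classical
  -- Sort with the predecessors of `i` or `j` first, then `i`, then `j`, then all other pipes.
  -- Inside a class, the number of predecessors respects the arcs, and the label breaks ties.
  let cls : Fin n → ℕ := fun k =>
    if P.ContactLess k i ∨ P.ContactLess k j then 0 else if k = i then 1 else if k = j then 2 else 3
  let height : Fin n → ℕ := fun k => #{l | P.ContactLess l k}
  let f : Fin n → ℕ ×ₗ ℕ ×ₗ Fin n := fun k => toLex (cls k, toLex (height k, k))
  have hf : Function.Injective f := fun x y hxy =>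
    congrArg (fun z => (ofLex (ofLex z).2).2) hxy
  have hsort : StrictMono (f ∘ Tuple.sort f) :=
    (Tuple.monotone_sort f).strictMono_of_injective (hf.comp (Tuple.sort f).injective)
  have hlt : ∀ x y, (Tuple.sort f).symm x < (Tuple.sort f).symm y ↔ f x < f y := fun x y => by
    rw [← hsort.lt_iff_lt]; simp
  have hi : cls i = 1 := by
    simp only [cls]
    rw [if_neg (not_or.2 ⟨hA i, h1⟩), if_pos trivial]
  have hj : cls j = 2 := by
    simp only [cls]
    rw [if_neg (not_or.2 ⟨h2, hA j⟩), if_neg hij.symm, if_pos trivial]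
  have hfij : f i < f j := by
    simp only [f, Prod.Lex.toLex_lt_toLex]
    left; omega
  refine ⟨Tuple.sort f, fun x y hxy => ?_, ?_⟩
  · rw [hlt]
    have hcls : cls x ≤ cls y := by
      have hx : P.ContactLess y i ∨ P.ContactLess y j → cls x = 0 := fun hy =>
        if_pos (hy.imp (fun h => .head hxy h) fun h => .head hxy h)
      have hx' : y = i ∨ y = j → cls x = 0 := by
        rintro (rfl | rfl)
        · exact if_pos (Or.inl (.single hxy))
        · exact if_pos (Or.inr (.single hxy))
      by_cases h3 : cls x = 0
      · omega
      · have h4 : cls y = 3 := by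
          simp only [cls]
          rw [if_neg (mt hx h3), if_neg fun h => h3 (hx' (Or.inl h)),
            if_neg fun h => h3 (hx' (Or.inr h))]
        rw [h4]
        simp only [cls]
        split_ifs <;> omega
    have hheight : height x < height y := by
      refine card_lt_card (Finset.ssubset_iff_of_subset (fun l hl => ?_) |>.2 ⟨x, ?_, ?_⟩)
      · simp only [mem_filter, mem_univ, true_and] at hl ⊢
        exact hl.tail hxy
      · simp only [mem_filter, mem_univ, true_and]
        exact .single hxy
      · simp only [mem_filter, mem_univ, true_and]
        exact hA x
    simp only [f, Prod.Lex.toLex_lt_toLex]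
    rcases hcls.lt_or_eq with h | h
    · exact Or.inl h
    · exact Or.inr ⟨h, Or.inl hheight⟩
  · have h3 := (hlt i j).2 hfij
    by_contra hne
    have h4 : ((Tuple.sort f).symm i : ℕ) + 1 < n := by omega
    set k := Tuple.sort f ⟨_, h4⟩ with hk
    have hks : (Tuple.sort f).symm k = ⟨_, h4⟩ := by rw [hk, Equiv.symm_apply_apply]
    have hik : f i < f k := by rw [← hlt, hks, Fin.lt_def]; simp
    have hkj : f k < f j := by rw [← hlt, hks, Fin.lt_def]; simp only; omega
    have hki : k ≠ i := fun h => by rw [h] at hik; exact lt_irrefl _ hik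
    have hkj' : k ≠ j := fun h => by rw [h] at hkj; exact lt_irrefl _ hkj
    have hck : cls k = 0 ∨ cls k = 3 := by
      simp only [cls, if_neg hki, if_neg hkj']
      split_ifs <;> simp
    simp only [f, Prod.Lex.toLex_lt_toLex] at hik hkj
    omega

end Filling

-- The congruence, its extremal elements and comparable pipes

open Filling

theorem PipeDreamCongruent.symm {π σ : WeakInterval ω} (h : PipeDreamCongruent ω π σ) :
    PipeDreamCongruent ω σ π := by
  obtain ⟨P, h1, h2, h3⟩ := h
  exact ⟨P, h1, h3, h2⟩

theorem PipeDreamCongruent.refl (π : WeakInterval ω) : PipeDreamCongruent ω π π := by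
  obtain ⟨P, h1, h2⟩ := exists_isLinearExtension π.2
  exact ⟨P, h1, h2, h2⟩

theorem PipeDreamCongruent.trans {π σ τ : WeakInterval ω} (h : PipeDreamCongruent ω π σ)
    (h' : PipeDreamCongruent ω σ τ) : PipeDreamCongruent ω π τ := by
  obtain ⟨P, h1, h2, h3⟩ := h
  obtain ⟨P', h1', h2', h3'⟩ := h'
  obtain rfl := eq_of_isLinearExtension h1.1 h1'.1 h1.2.1 h1'.2.1 h3 h2'
  exact ⟨P, h1, h2, h3'⟩

theorem pipeDreamCongruent_iff_swapCondition {π σ : WeakInterval ω}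
    (h : IsSwapAt π.perm σ.perm p q) :
    PipeDreamCongruent ω π σ ↔ SwapCondition ω π.perm p q := by
  obtain ⟨hpq, hlt, hσ⟩ := h
  have hp : σ.perm.symm (π.perm p) = q := by rw [hσ, swap_symm_left]
  have hq : σ.perm.symm (π.perm q) = p := by rw [hσ, swap_symm_right]
  have he := σ.2 _ _ hlt (show σ.perm.symm (π.perm q) < σ.perm.symm (π.perm p) by
    rw [hp, hq, Fin.lt_def]; omega)
  constructor
  · rintro ⟨P, ⟨hR, hω, -⟩, h1, h2⟩
    rw [← not_contactArc_iff_swapCondition hR hω h1 hpq hlt he]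
    intro harc
    have := h2 _ _ harc
    rw [hp, hq, Fin.lt_def] at this
    omega
  · intro h
    obtain ⟨P, hP, hπ⟩ := exists_isLinearExtension π.2
    refine ⟨P, hP, hπ, ?_⟩
    rw [hσ]
    exact hπ.swap hpq ((not_contactArc_iff_swapCondition hP.1 hP.2.1 hπ hpq hlt he).2 h)

theorem eqvGen_of_swap {π τ : WeakInterval ω} (hpq : (p : ℕ) + 1 = q)
    (hτ : τ.perm = π.perm * Equiv.swap p q) (h : PipeDreamCongruent ω π τ) :
    Relation.EqvGen (RewritingStep ω) π τ := by
  rcases lt_trichotomy (π.perm p) (π.perm q) with hlt | heq | hgt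
  · have hs : IsSwapAt π.perm τ.perm p q := ⟨hpq, hlt, hτ⟩
    exact .rel _ _ ⟨p, q, hs, (pipeDreamCongruent_iff_swapCondition hs).1 h⟩
  · have := π.perm.injective heq
    omega
  · have hs : IsSwapAt τ.perm π.perm p q := by
      refine ⟨hpq, by simpa [hτ] using hgt, ?_⟩
      rw [hτ, mul_assoc, Equiv.swap_mul_self, mul_one]
    exact .symm _ _ (.rel _ _ ⟨p, q, hs, (pipeDreamCongruent_iff_swapCondition hs).1 h.symm⟩)

theorem eqvGen_of_congruent {π σ : WeakInterval ω} (h : PipeDreamCongruent ω π σ) :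
    Relation.EqvGen (RewritingStep ω) π σ := by
  obtain ⟨P, hP, hπ, hσ⟩ := h
  -- Induction on the number of pairs ordered differently by `π` and `σ`; an exchange toward `σ`
  -- removes one and creates none.
  generalize hN : #{b : Fin n × Fin n | π.perm.symm b.1 < π.perm.symm b.2 ∧
    σ.perm.symm b.2 < σ.perm.symm b.1} = N
  induction N using Nat.strong_induction_on generalizing π with
  | _ N ih =>
    by_cases hne : π.perm = σ.perm
    · rw [show π = σ from Subtype.ext hne]
      exact .refl _
    obtain ⟨p, q, hpq, hlt, hτ⟩ := exists_swap_toward hπ hσ hne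
    let τ : WeakInterval ω := ⟨_, hτ.weakLE hP.1 hP.2.1⟩
    refine .trans _ τ _ (eqvGen_of_swap hpq rfl ⟨P, hP, hπ, hτ⟩) (ih _ ?_ hτ rfl)
    rw [← hN]
    refine card_lt_card (Finset.ssubset_iff_of_subset (fun b hb => ?_) |>.2
      ⟨(π.perm p, π.perm q), ?_, ?_⟩)
    · simp only [mem_filter, mem_univ, true_and] at hb ⊢
      refine ⟨(swap_symm_lt_iff hpq ?_ ?_).1 hb.1, hb.2⟩
      · rintro ⟨h1, h2⟩
        have h3 := hb.1
        simp only [τ, WeakInterval.perm] at h3 h1 h2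
        rw [h1, h2, swap_symm_left, swap_symm_right, Fin.lt_def] at h3
        omega
      · rintro ⟨h1, h2⟩
        have h3 := hb.2
        rw [h1, h2] at h3
        exact lt_asymm h3 hlt
    · simp only [mem_filter, mem_univ, true_and, Equiv.symm_apply_apply]
      exact ⟨by rw [Fin.lt_def]; omega, hlt⟩
    · simp only [mem_filter, mem_univ, true_and, not_and]
      intro h3
      simp only [τ, WeakInterval.perm] at h3
      rw [swap_symm_left, swap_symm_right, Fin.lt_def] at h3
      omega

theorem pipeDreamCongruent_iff_eqvGen {π σ : WeakInterval ω} :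
    PipeDreamCongruent ω π σ ↔ Relation.EqvGen (RewritingStep ω) π σ := by
  refine ⟨eqvGen_of_congruent, fun h => ?_⟩
  induction h with
  | rel π σ h =>
    obtain ⟨p, q, h1, h2⟩ := h
    exact (pipeDreamCongruent_iff_swapCondition h1).2 h2
  | refl π => exact .refl π
  | symm _ _ _ ih => exact ih.symm
  | trans _ _ _ _ _ ih ih' => exact ih.trans ih'

/-- For a descent, the pattern condition is the condition of the rewriting rule. -/
theorem swapCondition_iff_of_descent (hπ : WeakLE π ω) (hpq : (p : ℕ) + 1 = q)
    (hlt : π q < π p) : SwapCondition ω (π * Equiv.swap p q) p q ↔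
      HasLargeSubwordBefore ω π p (π q) (π p) := by
  have he := hπ _ _ hlt (by simp only [Equiv.symm_apply_apply, Fin.lt_def]; omega)
  rw [hasLargeSubwordBefore_iff hπ hlt he (by simp) (fun k _ hk => by simpa using hk),
    SwapCondition, lettersBefore_swap hpq]
  simp

theorem swapCondition_iff_of_ascent (hπ : WeakLE π ω) (hpq : (p : ℕ) + 1 = q)
    (hlt : π p < π q) (he : ω.symm (π q) < ω.symm (π p)) : SwapCondition ω π p q ↔
      HasLargeSubwordBefore ω π p (π p) (π q) := by
  rw [hasLargeSubwordBefore_iff hπ hlt he, SwapCondition]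
  · simp only [Equiv.symm_apply_apply, Fin.le_def]; omega
  · intro k hk hkq
    rw [Equiv.symm_apply_apply, Fin.lt_def] at hkq
    have hne : π.symm k ≠ p := fun h => hk (by rw [← h, Equiv.apply_symm_apply])
    rw [Fin.lt_def]
    omega

/-- If the class has a different element below `π`, an exchange toward it stays in the class and
must act on a descent of `π`, so non-minimality is visible on one adjacent exchange. -/
theorem minimal_iff (π : WeakInterval ω) : Minimal (PipeDreamCongruent ω π) π ↔
    ¬ ContainsDescentPattern ω π.perm := by
  constructor
  · rintro ⟨-, hmin⟩ ⟨p, q, i, j, hpq, hij, rfl, rfl, hlarge⟩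
    have hle := weakLE_of_swap_of_lt hpq hij
    let τ : WeakInterval ω := ⟨π.perm * Equiv.swap p q, fun i j h h' => π.2 i j h (hle i j h h')⟩
    have hs : IsSwapAt τ.perm π.perm p q := by
      refine ⟨hpq, by simpa [τ, WeakInterval.perm] using hij, ?_⟩
      simp only [τ, WeakInterval.perm]
      rw [mul_assoc, Equiv.swap_mul_self, mul_one]
    have hcong := (pipeDreamCongruent_iff_swapCondition hs).2
      ((swapCondition_iff_of_descent π.2 hpq hij).2 hlarge)
    have h1 := hmin hcong.symm hle (π.perm q) (π.perm p) hij
      (by simp only [Equiv.symm_apply_apply, Fin.lt_def]; omega)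
    simp only [τ, WeakInterval.perm] at h1
    rw [swap_symm_left, swap_symm_right, Fin.lt_def] at h1
    omega
  · intro hno
    refine ⟨.refl π, fun σ hσ hle => ?_⟩
    by_cases hne : π.perm = σ.perm
    · rw [show π = σ from Subtype.ext hne]
    exfalso
    obtain ⟨P, hP, h1, h2⟩ := hσ
    obtain ⟨p, q, hpq, hlt, hτ⟩ := exists_swap_toward h1 h2 hne
    have hgt : π.perm q < π.perm p := by
      rcases lt_trichotomy (π.perm p) (π.perm q) with h | h | h
      · have := hle _ _ h hlt
        simp only [Equiv.symm_apply_apply, Fin.lt_def] at this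
        omega
      · have := π.perm.injective h
        omega
      · exact h
    let τ : WeakInterval ω := ⟨_, hτ.weakLE hP.1 hP.2.1⟩
    have hs : IsSwapAt τ.perm π.perm p q := by
      refine ⟨hpq, by simpa [τ, WeakInterval.perm] using hgt, ?_⟩
      simp only [τ, WeakInterval.perm]
      rw [mul_assoc, Equiv.swap_mul_self, mul_one]
    have hcond := (pipeDreamCongruent_iff_swapCondition hs).1 ⟨P, hP, hτ, h1⟩
    exact hno ⟨p, q, _, _, hpq, hgt, rfl, rfl, (swapCondition_iff_of_descent π.2 hpq hgt).1 hcond⟩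

/-- This guarantees that exchanging the ascent of a pattern stays in `[e, ω]`. Otherwise `i` itself
is counted in the length of the subword, so some `k > i` precedes `i` in `π`; then `ω` places `k`
before `i`, hence before `j`, contrary to the choice of `k`. -/
theorem HasLargeSubwordBefore.inverted (hπ : WeakLE π ω)
    (hlt : π p < π q) (h : HasLargeSubwordBefore ω π p (π p) (π q)) :
    ω.symm (π q) < ω.symm (π p) := by
  by_contra hc
  have hne : ω.symm (π p) ≠ ω.symm (π q) := fun h => hlt.ne (ω.symm.injective h)
  have he := lt_of_le_of_ne (not_lt.1 hc) hne
  obtain ⟨s, -, hs⟩ := h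
  obtain ⟨h1, h2, h3⟩ := hs ⟨0, card_pos.2 ⟨π p, by simpa using he⟩⟩
  have := hπ _ _ h2 (by simpa using h1)
  exact lt_asymm this (he.trans h3)

theorem maximal_iff (π : WeakInterval ω) : Maximal (PipeDreamCongruent ω π) π ↔
    ¬ ContainsAscentPattern ω π.perm := by
  constructor
  · rintro ⟨-, hmax⟩ ⟨p, q, i, j, hpq, hij, rfl, rfl, hlarge⟩
    have he := hlarge.inverted π.2 hij
    have hle := weakLE_swap_of_lt hpq hij
    have hτ : WeakLE (π.perm * Equiv.swap p q) ω := by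
      intro x y hxy hyx
      by_cases h1 : y = π.perm q ∧ x = π.perm p
      · rw [h1.1, h1.2]; exact he
      · refine π.2 x y hxy ((swap_symm_lt_iff hpq ?_ h1).1 hyx)
        rintro ⟨rfl, rfl⟩
        exact lt_asymm hxy hij
    let τ : WeakInterval ω := ⟨_, hτ⟩
    have hs : IsSwapAt π.perm τ.perm p q := ⟨hpq, hij, rfl⟩
    have hcong := (pipeDreamCongruent_iff_swapCondition hs).2
      ((swapCondition_iff_of_ascent π.2 hpq hij he).2 hlarge)
    have h1 := hmax hcong hle (π.perm p) (π.perm q) hij (by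
      simp only [τ, WeakInterval.perm]
      rw [swap_symm_left, swap_symm_right, Fin.lt_def]
      omega)
    simp only [Equiv.symm_apply_apply, Fin.lt_def] at h1
    omega
  · intro hno
    refine ⟨.refl π, fun σ hσ hle => ?_⟩
    by_cases hne : π.perm = σ.perm
    · rw [show π = σ from Subtype.ext hne]
    exfalso
    obtain ⟨P, hP, h1, h2⟩ := hσ
    obtain ⟨p, q, hpq, hlt, hτ⟩ := exists_swap_toward h1 h2 hne
    have hgt : π.perm p < π.perm q := by
      rcases lt_trichotomy (π.perm p) (π.perm q) with h | h | h
      · exact h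
      · have := π.perm.injective h
        omega
      · have := hle _ _ h (by simp only [Equiv.symm_apply_apply, Fin.lt_def]; omega)
        exact absurd this hlt.not_gt
    have hτω := hτ.weakLE hP.1 hP.2.1
    let τ : WeakInterval ω := ⟨_, hτω⟩
    have hs : IsSwapAt π.perm τ.perm p q := ⟨hpq, hgt, rfl⟩
    have hcond := (pipeDreamCongruent_iff_swapCondition hs).1 ⟨P, hP, h1, hτ⟩
    have he := hτω _ _ hgt (by rw [swap_symm_left, swap_symm_right, Fin.lt_def]; omega)
    exact hno ⟨p, q, _, _, hpq, hgt, rfl, rfl, (swapCondition_iff_of_ascent π.2 hpq hgt he).1 hcond⟩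

theorem contactLess_or_contactLess {i j : Fin n} (hij : i < j)
    (hcard : (j : ℕ) - (i : ℕ) ≤ #{k : Fin n | k ≤ i ∧ ω.symm k < ω.symm j}) {P : Filling n}
    (hP : P.IsAcyclicPipeDream ω) : P.ContactLess i j ∨ P.ContactLess j i := by
  by_contra hc
  obtain ⟨h1, h2⟩ := not_or.1 hc
  have hne : ω.symm i ≠ ω.symm j := fun h => hij.ne (ω.symm.injective h)
  have he : ω.symm j < ω.symm i := by
    by_contra hlt
    exact h1 (contactLess_of_noninversion hP.1 hP.2.1 hij (lt_of_le_of_ne (not_lt.1 hlt) hne))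
  obtain ⟨π, hπ, hadj⟩ := exists_adjacent_linearExtension hP.2.2 hij.ne h1 h2
  have hπω := hπ.weakLE hP.1 hP.2.1
  have hi : π (π.symm i) = i := by simp
  have hj : π (π.symm j) = j := by simp
  have hcond := (not_contactArc_iff_swapCondition hP.1 hP.2.1 hπ hadj (by rwa [hi, hj])
    (by rwa [hi, hj])).1 fun harc => h1 (by rw [hi, hj] at harc; exact .single harc)
  rw [swapCondition_iff_of_ascent hπω hadj (by rwa [hi, hj]) (by rwa [hi, hj]), hi, hj,
    hasLargeSubwordBefore_iff_card] at hcond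
  -- Such a `k` precedes `j` in `π` but follows it in `ω`, so `k > j` would be an inversion of `π`
  -- absent from `ω`. Only `j - i - 1` values are left.
  have hsub : #{k ∈ lettersBefore π (π.symm i) | i < k ∧ ω.symm j < ω.symm k} ≤
      #(Ioo i j) := by
    refine card_le_card fun k hk => ?_
    simp only [lettersBefore, mem_filter, mem_univ, true_and] at hk
    obtain ⟨h3, h4, h5⟩ := hk
    have h6 : π.symm k < π.symm j := by rw [Fin.lt_def] at *; omega
    refine mem_Ioo.2 ⟨h4, ?_⟩
    rcases lt_trichotomy k j with h | rfl | h
    · exact h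
    · exact absurd h6 (lt_irrefl _)
    · exact absurd (hπω _ _ h h6) h5.not_gt
  rw [Fin.card_Ioo] at hsub
  have : (i : ℕ) < j := hij
  omega

end PipeDreams

theorem proposition4p6 (n : ℕ) (ω : Equiv.Perm (Fin n)) :
    -- the congruence is the equivalence relation generated by the rewriting rule
    (∀ π σ : PipeDreams.WeakInterval ω,
      PipeDreams.PipeDreamCongruent ω π σ ↔
        Relation.EqvGen (PipeDreams.RewritingStep ω) π σ) ∧
    -- the swaps inside a class are exactly those allowed by the rule
    (∀ (π σ : PipeDreams.WeakInterval ω) (p q : Fin n),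
      PipeDreams.IsSwapAt π.perm σ.perm p q →
        (PipeDreams.PipeDreamCongruent ω π σ ↔ PipeDreams.SwapCondition ω π.perm p q)) ∧
    -- minimal and maximal elements of the classes
    (∀ π : PipeDreams.WeakInterval ω,
      Minimal (PipeDreams.PipeDreamCongruent ω π) π ↔
        ¬ PipeDreams.ContainsDescentPattern ω π.perm) ∧
    (∀ π : PipeDreams.WeakInterval ω,
      Maximal (PipeDreams.PipeDreamCongruent ω π) π ↔
        ¬ PipeDreams.ContainsAscentPattern ω π.perm) ∧
    -- pipes that are always comparable
    (∀ i j : Fin n, i < j →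
      (j : ℕ) - (i : ℕ) ≤ Finset.card {k : Fin n | k ≤ i ∧ ω.symm k < ω.symm j} →
        ∀ P : PipeDreams.Filling n, P.IsAcyclicPipeDream ω →
          P.ContactLess i j ∨ P.ContactLess j i) := by
  exact ⟨fun _ _ => PipeDreams.pipeDreamCongruent_iff_eqvGen,
    fun _ _ _ _ h => PipeDreams.pipeDreamCongruent_iff_swapCondition h,
    PipeDreams.minimal_iff, PipeDreams.maximal_iff,
    fun _ _ hij hcard _ hP => PipeDreams.contactLess_or_contactLess hij hcard hP⟩
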